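/- Let $n\ge 2$ and $m>1$. For a domain $\Omega\subsetneq\mathbb{C}^n$, $z\in\Omega$ and $v\in\mathbb{C}^n\setminus\{0\}$ put $$\delta(z)=\inf\{|z-\xi|:\xi\in\partial\Omega\},\qquad \delta(z;v)=\inf\{|z-\xi|:\xi\in\partial\Omega\cap(z+\mathbb{C}v)\}.$$ A bounded convex domain $\Omega\subset\mathbb{C}^n$ is called $m$-convex if there is $C_0>0$ with $\delta(z;v)\le C_0\,\delta(z)^{1/m}$ for all $z\in\Omega$ and all $v\in\mathbb{C}^n\setminus\{0\}$. The Kobayashi metric of $\Omega$ is $$K(z;v)=\inf\{|\xi| : \xi\in\mathbb{C},\ f:\mathbb{D}\to\Omega \text{ holomorphic},\ f(0)=z,\ f'(0)\,\xi=v\}$$ and the Kobayashi distance $d_K(x,y)$ is the infimum of $\int_0^1K(\gamma(t);\gamma'(t))\,dt$ over all piecewise $C^1$ curves $\gamma:[0,1]\to\Omega$ with $\gamma(0)=x$, $\gamma(1)=y$. A Kobayashi geodesic from $x$ to $y$ is a map $\gamma:[0,d_K(x,y)]\to\Omega$ with $\gamma(0)=x$, $\gamma(d_K(x,y))=y$ and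 $d_K(\gamma(s),\gamma(t))=|s-t|$ for all $s,t$. Let $\Omega\subset\mathbb{C}^n$ be a bounded $m$-convex domain. Then any two points of $\Omega$ are joined by a Kobayashi geodesic, and there is a constant $C>0$ such that, for all $x,y\in\Omega$ and every Kobayashi geodesic $[x,y]$ from $x$ to $y$, the Euclidean length $L([x,y])$ is finite and $$d_K(x,y)\ \ge\ \log\left(\frac{L([x,y])^m+\max\{\delta(x),\delta(y)\}}{\sqrt{\delta(x)\,\delta(y)}}\right)-C .$$ -/

import Mathlib

open Set MeasureTheory
open scoped ENNReal

noncomputable section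

/-- The Euclidean distance `δ_Ω(z)` from `z` to the boundary of `Ω ⊂ ℂⁿ`. -/
def bdryDist {n : ℕ} (Ω : Set (EuclideanSpace ℂ (Fin n))) (z : EuclideanSpace ℂ (Fin n)) : ℝ :=
  Metric.infDist z (frontier Ω)

/-- The distance `δ_Ω(z; v)` from `z` to the boundary of `Ω` inside the complex line `z + ℂ v`. -/
def bdryDistAlong {n : ℕ} (Ω : Set (EuclideanSpace ℂ (Fin n)))
    (z v : EuclideanSpace ℂ (Fin n)) : ℝ :=
  Metric.infDist z (frontier Ω ∩ range fun c : ℂ => z + c • v)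

/-- Bounded `m`-convex domains (`m > 1` real). Directions `v` are nonzero: for `v = 0` there is no
boundary point on the "line" `{z}`, and the directional distance is not meaningful. -/
structure IsMConvex {n : ℕ} (Ω : Set (EuclideanSpace ℂ (Fin n))) (m : ℝ) : Prop where
  isOpen : IsOpen Ω
  nonempty : Ω.Nonempty
  isBounded : Bornology.IsBounded Ω
  convex : Convex ℝ Ω
  one_lt : 1 < m
  exists_bound : ∃ C : ℝ, 0 < C ∧ ∀ z ∈ Ω, ∀ v : EuclideanSpace ℂ (Fin n), v ≠ 0 →
    bdryDistAlong Ω z v ≤ C * bdryDist Ω z ^ (1 / m)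

/-- The infinitesimal Kobayashi metric
`K_Ω(z; v) = inf {|ξ| : f ∈ Hol(𝔻, Ω), f(0) = z, df₀(ξ) = v}`, valued in `[0, ∞]`. -/
def kobayashiMetric {n : ℕ} (Ω : Set (EuclideanSpace ℂ (Fin n)))
    (z v : EuclideanSpace ℂ (Fin n)) : ℝ≥0∞ :=
  sInf {r : ℝ≥0∞ | ∃ (f : ℂ → EuclideanSpace ℂ (Fin n)) (ξ : ℂ),
    DifferentiableOn ℂ f (Metric.ball 0 1) ∧ MapsTo f (Metric.ball 0 1) Ω ∧
      f 0 = z ∧ ξ • deriv f 0 = v ∧ r = ‖ξ‖ₑ}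

/-- `γ : [0, 1] → ℂⁿ` is piecewise `C¹`: there is a partition `0 = t₀ ≤ t₁ ≤ ⋯ ≤ t_k = 1` such that
`γ` is `C¹` on each closed interval `[t_i, t_{i+1}]` (so `γ` is continuous on `[0, 1]`). -/
def IsPiecewiseC1 {n : ℕ} (γ : ℝ → EuclideanSpace ℂ (Fin n)) : Prop :=
  ∃ (k : ℕ) (t : ℕ → ℝ), Monotone t ∧ t 0 = 0 ∧ t k = 1 ∧
    ∀ i < k, ContDiffOn ℝ 1 γ (Icc (t i) (t (i + 1)))

/-- The Kobayashi length `∫₀¹ K_Ω(γ(t); γ'(t)) dt` of a curve `γ : [0, 1] → Ω`. -/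
def kobayashiLength {n : ℕ} (Ω : Set (EuclideanSpace ℂ (Fin n)))
    (γ : ℝ → EuclideanSpace ℂ (Fin n)) : ℝ≥0∞ :=
  ∫⁻ t in Icc (0 : ℝ) 1, kobayashiMetric Ω (γ t) (deriv γ t)

/-- The Kobayashi distance of `Ω` as an element of `[0, ∞]`: the infimum of the Kobayashi lengths
of the piecewise `C¹` curves in `Ω` from `x` to `y`. -/
def kobayashiEDist {n : ℕ} (Ω : Set (EuclideanSpace ℂ (Fin n)))
    (x y : EuclideanSpace ℂ (Fin n)) : ℝ≥0∞ :=
  sInf {r : ℝ≥0∞ | ∃ γ : ℝ → EuclideanSpace ℂ (Fin n), IsPiecewiseC1 γ ∧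
    MapsTo γ (Icc 0 1) Ω ∧ γ 0 = x ∧ γ 1 = y ∧ r = kobayashiLength Ω γ}

/-- The Kobayashi distance `d_K(x, y)` as a real number. -/
def kobayashiDist {n : ℕ} (Ω : Set (EuclideanSpace ℂ (Fin n)))
    (x y : EuclideanSpace ℂ (Fin n)) : ℝ :=
  (kobayashiEDist Ω x y).toReal

/-- `γ` is (on `[0, d_K(x, y)]`) a Kobayashi geodesic of `Ω` from `x` to `y`: an isometry of the
interval `[0, d_K(x, y)]` into `(Ω, d_K)` with `γ(0) = x` and `γ(d_K(x, y)) = y`. -/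
structure IsKobayashiGeodesic {n : ℕ} (Ω : Set (EuclideanSpace ℂ (Fin n)))
    (x y : EuclideanSpace ℂ (Fin n)) (γ : ℝ → EuclideanSpace ℂ (Fin n)) : Prop where
  mapsTo : MapsTo γ (Icc 0 (kobayashiDist Ω x y)) Ω
  source : γ 0 = x
  target : γ (kobayashiDist Ω x y) = y
  isometry : ∀ s ∈ Icc 0 (kobayashiDist Ω x y), ∀ t ∈ Icc 0 (kobayashiDist Ω x y),
    kobayashiEDist Ω (γ s) (γ t) = ENNReal.ofReal |s - t|

/-- The Euclidean length, in `[0, ∞]`, of the restriction of `γ` to `[0, T]`. -/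
def euclideanLength {n : ℕ} (γ : ℝ → EuclideanSpace ℂ (Fin n)) (T : ℝ) : ℝ≥0∞ :=
  eVariationOn γ (Icc 0 T)

end

/-! Everything rests on two lower bounds for the Kobayashi metric, both obtained by mapping a convex
domain into a supporting half-plane and applying Schwarz–Pick.

The first bound uses a half-space `Re L < c` supporting Ω at a boundary point closest to w. The
function `½ log (c - Re L)` is 1-Lipschitz for the Kobayashi distance, and comparing boundary
distances through it gives `δ(y) ≤ δ(x) exp (2 d)` whenever x and y are at distance at most d
(`bdryDist_le_mul_exp`). The second bound supports Ω at the nearest boundary point in the complex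
line `z + ℂ v`; with m-convexity it gives `K(z; v) ≥ ‖v‖ / (A δ(z) ^ (1/m))`.

Along a geodesic leaving x, the Euclidean speed at time t is therefore at most a constant times
`(δ(x) exp (2t)) ^ (1/m)`. Integrating, the length up to time τ is at most a constant times the
final value `(δ(x) exp (2τ)) ^ (1/m)`. For a geodesic of duration T, the same holds from y
backwards. Cutting at the τ where `δ(x) exp (2τ) = δ(y) exp (2(T - τ))`, a quantity then equal to `P
= √(δ(x)δ(y)) exp T`, gives `L ^ m ≤ B ^ m P`. The growth estimate also gives `max (δ(x), δ(y)) ≤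
P`. Adding and taking logarithms proves the inequality.

Geodesics exist by compactness: almost minimizing curves, parametrized by Kobayashi arc length, stay
in a fixed compact set, and Tychonoff's theorem yields a limit. -/

/-- The infinitesimal Schwarz–Pick inequality for maps from the disc to the right half-plane. -/
theorem norm_deriv_le_two_mul_re {g : ℂ → ℂ} (hg : DifferentiableOn ℂ g (Metric.ball 0 1))
    (hpos : ∀ ζ ∈ Metric.ball (0 : ℂ) 1, 0 < (g ζ).re) :
    ‖deriv g 0‖ ≤ 2 * (g 0).re := by
  have h0 : (0 : ℂ) ∈ Metric.ball (0 : ℂ) 1 := by simp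
  set a := g 0 with ha
  have hapos : 0 < a.re := hpos 0 h0
  have hden : ∀ ζ ∈ Metric.ball (0 : ℂ) 1, g ζ + (starRingEnd ℂ) a ≠ 0 := by
    intro ζ hζ h
    have := congrArg Complex.re h
    simp at this
    linarith [hpos ζ hζ]
  -- Cayley transform of the half-plane taking a to 0. The Schwarz lemma bounds `h'(0) = g'(0) / (2
  -- Re a)` by 1.
  set h : ℂ → ℂ := fun ζ => (g ζ - a) / (g ζ + (starRingEnd ℂ) a) with hh
  have hh0 : h 0 = 0 := by simp [hh, ha]
  have hd : DifferentiableOn ℂ h (Metric.ball 0 1) :=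
    (hg.sub_const a).div (hg.add_const _) hden
  have hmaps : MapsTo h (Metric.ball 0 1) (Metric.closedBall (h 0) 1) := by
    intro ζ hζ
    rw [hh0, mem_closedBall_zero_iff, hh]
    simp only [norm_div]
    rw [div_le_one (norm_pos_iff.2 (hden ζ hζ)), ← sq_le_sq₀ (norm_nonneg _) (norm_nonneg _),
      Complex.sq_norm, Complex.sq_norm, Complex.normSq_apply, Complex.normSq_apply]
    simp
    nlinarith [hpos ζ hζ, mul_pos (hpos ζ hζ) hapos]
  have key := Complex.norm_deriv_le_div_of_mapsTo_ball hd hmaps one_pos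
  have hgd : HasDerivAt g (deriv g 0) 0 :=
    (hg.differentiableAt (Metric.isOpen_ball.mem_nhds h0)).hasDerivAt
  have hhd := (hgd.sub_const a).div (hgd.add_const ((starRingEnd ℂ) a)) (hden 0 h0)
  have haa : a + (starRingEnd ℂ) a = ((2 * a.re : ℝ) : ℂ) := Complex.add_conj a
  have hderiv : deriv h 0 = deriv g 0 / ((2 * a.re : ℝ) : ℂ) := by
    have h2 : ((2 * a.re : ℝ) : ℂ) ≠ 0 := by exact_mod_cast (by positivity)
    rw [show deriv h 0 = _ from HasDerivAt.deriv hhd, ← ha, haa]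
    field_simp
    ring
  rw [hderiv, norm_div, Complex.norm_real, Real.norm_of_nonneg (by positivity),
    div_le_div_iff₀ (by positivity) one_pos] at key
  linarith

/-! ### Half-space and ball bounds for the infinitesimal Kobayashi metric -/

section
variable {n : ℕ} {Ω : Set (EuclideanSpace ℂ (Fin n))}

/-- For each competing disc f, the function `c - L ∘ f` maps into the right half-plane, so
Schwarz–Pick applies at 0. -/
theorem ofReal_le_kobayashiMetric (L : EuclideanSpace ℂ (Fin n) →L[ℂ] ℂ) (c : ℝ)
    (hL : ∀ p ∈ Ω, (L p).re < c) {z : EuclideanSpace ℂ (Fin n)} (hz : z ∈ Ω)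
    (v : EuclideanSpace ℂ (Fin n)) :
    ENNReal.ofReal (‖L v‖ / (2 * (c - (L z).re))) ≤ kobayashiMetric Ω z v := by
  refine le_sInf ?_
  rintro r ⟨f, ξ, hf, hmaps, hf0, hv, rfl⟩
  have h0 : (0 : ℂ) ∈ Metric.ball (0 : ℂ) 1 := by simp
  have hfd : HasDerivAt f (deriv f 0) 0 :=
    (hf.differentiableAt (Metric.isOpen_ball.mem_nhds h0)).hasDerivAt
  have hgd : HasDerivAt (fun ζ => (c : ℂ) - L (f ζ)) (-L (deriv f 0)) 0 :=
    (L.hasFDerivAt.comp_hasDerivAt (0 : ℂ) hfd).const_sub _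
  have key := norm_deriv_le_two_mul_re (g := fun ζ => (c : ℂ) - L (f ζ))
    ((L.differentiable.comp_differentiableOn hf).const_sub _) (fun ζ hζ => by
      simpa using hL _ (hmaps hζ))
  rw [hgd.deriv, norm_neg, hf0] at key
  simp only [Complex.sub_re, Complex.ofReal_re] at key
  have hpos : 0 < c - (L z).re := sub_pos.2 (hL z hz)
  rw [← ofReal_norm]
  refine ENNReal.ofReal_le_ofReal ?_
  rw [div_le_iff₀ (by positivity), ← hv, map_smul, norm_smul]
  exact mul_le_mul_of_nonneg_left key (norm_nonneg _)

theorem kobayashiMetric_smul_le (z v : EuclideanSpace ℂ (Fin n)) (c : ℂ) (hc : c ≠ 0) :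
    kobayashiMetric Ω z (c • v) ≤ ‖c‖ₑ * kobayashiMetric Ω z v := by
  have h0 : ‖c‖ₑ ≠ 0 := by simpa
  rw [kobayashiMetric, kobayashiMetric, sInf_eq_iInf (s := {r : ℝ≥0∞ | ∃ f ξ, _ ∧ _ ∧ _ ∧ ξ • _ = v ∧ _}),
    ENNReal.mul_iInf_of_ne h0 enorm_ne_top]
  simp_rw [ENNReal.mul_iInf_of_ne h0 enorm_ne_top]
  refine le_iInf₂ ?_
  rintro r ⟨f, ξ, hf, hmaps, hf0, hv, rfl⟩
  refine sInf_le ⟨f, c * ξ, hf, hmaps, hf0, ?_, ?_⟩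
  · rw [mul_smul, hv]
  · rw [enorm_mul]

theorem kobayashiMetric_real_smul_le (z v : EuclideanSpace ℂ (Fin n)) (c : ℝ) (hc : c ≠ 0) :
    kobayashiMetric Ω z (c • v) ≤ ENNReal.ofReal |c| * kobayashiMetric Ω z v := by
  have := kobayashiMetric_smul_le (Ω := Ω) z v (c : ℂ) (by exact_mod_cast hc)
  simpa [← ofReal_norm] using this

theorem kobayashiMetric_le_of_ball_subset {z : EuclideanSpace ℂ (Fin n)} {r : ℝ} (hr : 0 < r)
    (hball : Metric.ball z r ⊆ Ω) (v : EuclideanSpace ℂ (Fin n)) :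
    kobayashiMetric Ω z v ≤ ENNReal.ofReal (‖v‖ / r) := by
  rcases eq_or_ne v 0 with rfl | hv
  · refine sInf_le ⟨fun _ => z, 0, differentiableOn_const _, fun _ _ => hball (by simpa), rfl, ?_, ?_⟩
    · simp
    · simp
  have hv' : 0 < ‖v‖ := norm_pos_iff.2 hv
  have hd : ∀ ζ : ℂ, HasDerivAt (fun ζ : ℂ => z + ζ • ((r / ‖v‖ : ℝ) • v)) ((r / ‖v‖ : ℝ) • v) ζ := by
    intro ζ
    simpa using ((hasDerivAt_id ζ).smul_const ((r / ‖v‖ : ℝ) • v)).const_add z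
  refine sInf_le ⟨fun ζ => z + ζ • ((r / ‖v‖ : ℝ) • v), ((‖v‖ / r : ℝ) : ℂ),
    fun ζ _ => (hd ζ).differentiableAt.differentiableWithinAt, ?_, by simp, ?_, ?_⟩
  · intro ζ hζ
    apply hball
    rw [mem_ball_zero_iff] at hζ
    rw [mem_ball_iff_norm, add_sub_cancel_left, norm_smul, norm_smul, Real.norm_of_nonneg (by positivity),
      div_mul_cancel₀ _ hv'.ne']
    nlinarith
  · rw [(hd 0).deriv, Complex.coe_smul, smul_smul]
    rw [show ‖v‖ / r * (r / ‖v‖) = 1 by field_simp, one_smul]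
  · rw [← ofReal_norm, Complex.norm_real, Real.norm_of_nonneg (by positivity)]

end

/-! ### Boundary distance, supporting half-spaces and m-convexity -/

section
variable {n : ℕ} {Ω : Set (EuclideanSpace ℂ (Fin n))}

theorem bdryDist_eq_infDist_compl (ho : IsOpen Ω) (hne : Ω ≠ univ)
    {z : EuclideanSpace ℂ (Fin n)} (hz : z ∈ Ω) : bdryDist Ω z = Metric.infDist z Ωᶜ := by
  obtain ⟨y, hy, hyd⟩ := exists_mem_frontier_infDist_compl_eq_dist hz hne
  refine le_antisymm (hyd ▸ Metric.infDist_le_dist_of_mem hy) ?_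
  refine Metric.infDist_le_infDist_of_subset ?_ ⟨y, hy⟩
  rw [ho.frontier_eq]
  exact fun p hp => hp.2

theorem ball_bdryDist_subset (ho : IsOpen Ω) (hne : Ω ≠ univ)
    {z : EuclideanSpace ℂ (Fin n)} (hz : z ∈ Ω) : Metric.ball z (bdryDist Ω z) ⊆ Ω := by
  rw [bdryDist_eq_infDist_compl ho hne hz]
  exact Metric.ball_infDist_compl_subset

theorem bdryDist_pos (ho : IsOpen Ω) (hne : Ω ≠ univ)
    {z : EuclideanSpace ℂ (Fin n)} (hz : z ∈ Ω) : 0 < bdryDist Ω z := by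
  rw [bdryDist_eq_infDist_compl ho hne hz]
  exact (ho.isClosed_compl.notMem_iff_infDist_pos (nonempty_compl.2 hne)).1 (by simpa)

/-- A supporting half-space at a boundary point closest to `w` compares the boundary distances of
`w` and of any other point. -/
theorem exists_supporting_functional (ho : IsOpen Ω) (hconv : Convex ℝ Ω) (hne : Ω ≠ univ)
    {w : EuclideanSpace ℂ (Fin n)} (hw : w ∈ Ω) :
    ∃ (L : EuclideanSpace ℂ (Fin n) →L[ℂ] ℂ) (c : ℝ), (∀ p ∈ Ω, (L p).re < c) ∧
      ∀ z ∈ Ω, bdryDist Ω z * (c - (L w).re) ≤ bdryDist Ω w * (c - (L z).re) := by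
  obtain ⟨y, hy, hyd⟩ := exists_mem_frontier_infDist_compl_eq_dist hw hne
  rw [← bdryDist_eq_infDist_compl ho hne hw] at hyd
  have hyΩ : y ∉ Ω := by rw [ho.frontier_eq] at hy; exact hy.2
  obtain ⟨L, hL⟩ := RCLike.geometric_hahn_banach_open_point (𝕜 := ℂ) hconv ho hyΩ
  simp only [RCLike.re_to_complex] at hL
  refine ⟨L, (L y).re, hL, fun z hz => ?_⟩
  have hδw := bdryDist_pos ho hne hw
  have hδz := bdryDist_pos ho hne hz
  -- Since `‖y - w‖ = δ(w)`, the point `z + s (y - w)` stays in the ball of radius δ(z) about z,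
  -- hence in the half-space. Letting s tend to the ratio of the distances gives `hlim`.
  have key : ∀ s ∈ Ico 0 (bdryDist Ω z / bdryDist Ω w),
      s * ((L y).re - (L w).re) ≤ (L y).re - (L z).re := by
    rintro s ⟨hs0, hs⟩
    have : z + s • (y - w) ∈ Ω := by
      apply ball_bdryDist_subset ho hne hz
      rw [mem_ball_iff_norm, add_sub_cancel_left, norm_smul, Real.norm_of_nonneg hs0,
        ← dist_eq_norm, dist_comm, ← hyd]
      rwa [lt_div_iff₀ hδw] at hs
    have := hL _ this
    rw [map_add, ← Complex.coe_smul, map_smul, map_sub] at this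
    simp at this
    linarith
  have hlim : bdryDist Ω z / bdryDist Ω w * ((L y).re - (L w).re) ≤ (L y).re - (L z).re := by
    by_contra! hcon
    have hpos : 0 < (L y).re - (L w).re := sub_pos.2 (hL w hw)
    have hpos' : 0 < (L y).re - (L z).re := sub_pos.2 (hL z hz)
    obtain ⟨s, hs1, hs2⟩ := exists_between ((div_lt_iff₀ hpos).2 hcon)
    have := key s ⟨by have := div_pos hpos' hpos; linarith, hs2⟩
    rw [div_lt_iff₀ hpos] at hs1
    linarith
  rw [div_mul_eq_mul_div, div_le_iff₀ hδw] at hlim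
  linarith

/-- A complex line is connected and unbounded, so it must leave Ω through the frontier. This keeps
`bdryDistAlong` from being the default value 0 of `infDist` to the empty set. -/
theorem frontier_inter_line_nonempty (ho : IsOpen Ω) (hb : Bornology.IsBounded Ω)
    {z v : EuclideanSpace ℂ (Fin n)} (hz : z ∈ Ω) (hv : v ≠ 0) :
    (frontier Ω ∩ range fun c : ℂ => z + c • v).Nonempty := by
  have hcont : Continuous fun c : ℂ => z + c • v := by fun_prop
  have hconn : IsPreconnected (range fun c : ℂ => z + c • v) := isPreconnected_range hcont
  by_contra hemp
  have hsub : (range fun c : ℂ => z + c • v) ⊆ Ω := by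
    by_contra hns
    rw [not_subset] at hns
    obtain ⟨p, hp, hpΩ⟩ := hns
    have hcover : ∀ q ∈ range fun c : ℂ => z + c • v, q ∈ closure Ω → q ∈ Ω := fun q hq hqc => by
      by_contra hqΩ
      exact hemp ⟨q, ho.frontier_eq ▸ ⟨hqc, hqΩ⟩, hq⟩
    obtain ⟨q, -, hq1, hq2⟩ := hconn Ω (closure Ω)ᶜ ho isClosed_closure.isOpen_compl
      (fun q hq => (em (q ∈ closure Ω)).imp (hcover q hq) id)
      ⟨z, ⟨0, by simp⟩, hz⟩ ⟨p, hp, fun hpc => hpΩ (hcover p hp hpc)⟩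
    exact hq2 (subset_closure hq1)
  obtain ⟨R, hR⟩ := hb.subset_closedBall z
  have hv' : 0 < ‖v‖ := norm_pos_iff.2 hv
  have := hR (hsub ⟨(((|R| + 1) / ‖v‖ : ℝ) : ℂ), rfl⟩)
  rw [mem_closedBall_iff_norm, add_sub_cancel_left, norm_smul, Complex.norm_real,
    Real.norm_of_nonneg (by positivity), div_mul_cancel₀ _ hv'.ne'] at this
  linarith [le_abs_self R]

/-- Let `y = z + c • v` be the nearest frontier point in the line, and L a functional supporting Ω
at y. The gap `Re L(y - z)` is at most `‖c‖ ‖L v‖`, so ‖L v‖ cancels from the half-plane bound. -/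
theorem ofReal_le_kobayashiMetric_of_convex (ho : IsOpen Ω) (hb : Bornology.IsBounded Ω)
    (hconv : Convex ℝ Ω) {z v : EuclideanSpace ℂ (Fin n)} (hz : z ∈ Ω) (hv : v ≠ 0) :
    0 < bdryDistAlong Ω z v ∧
      ENNReal.ofReal (‖v‖ / (2 * bdryDistAlong Ω z v)) ≤ kobayashiMetric Ω z v := by
  have hne := frontier_inter_line_nonempty ho hb hz hv
  have hinj : Topology.IsClosedEmbedding fun c : ℂ => c • v :=
    LinearMap.isClosedEmbedding_of_injective (f := LinearMap.toSpanSingleton ℂ _ v)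
      (LinearMap.ker_toSpanSingleton ℂ hv)
  have hcl : IsClosed (frontier Ω ∩ range fun c : ℂ => z + c • v) :=
    isClosed_frontier.inter ((Homeomorph.addLeft z).isClosedEmbedding.comp hinj).isClosed_range
  obtain ⟨y, ⟨hyf, c, hcy⟩, hyd⟩ := hcl.exists_infDist_eq_dist hne z
  have hyΩ : y ∉ Ω := by rw [ho.frontier_eq] at hyf; exact hyf.2
  have hδ : bdryDistAlong Ω z v = ‖c‖ * ‖v‖ := by
    rw [bdryDistAlong, hyd, ← hcy, dist_eq_norm]
    simp [norm_smul]
  have hc : c ≠ 0 := by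
    rintro rfl
    apply hyΩ
    rw [← hcy]
    simpa using hz
  obtain ⟨L, hL⟩ := RCLike.geometric_hahn_banach_open_point (𝕜 := ℂ) hconv ho hyΩ
  simp only [RCLike.re_to_complex] at hL
  have hc' : 0 < ‖c‖ := norm_pos_iff.2 hc
  have hv' : 0 < ‖v‖ := norm_pos_iff.2 hv
  refine ⟨by rw [hδ]; positivity, le_trans ?_ (ofReal_le_kobayashiMetric L _ hL hz v)⟩
  apply ENNReal.ofReal_le_ofReal
  have hpos : 0 < (L y).re - (L z).re := sub_pos.2 (hL z hz)
  have hle : (L y).re - (L z).re ≤ ‖c‖ * ‖L v‖ := by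
    rw [← norm_mul, ← smul_eq_mul, ← map_smul, ← Complex.sub_re, ← map_sub, ← hcy]
    simpa using Complex.re_le_norm (L (c • v))
  rw [hδ, div_le_div_iff₀ (by positivity) (by positivity)]
  nlinarith

theorem IsMConvex.ne_univ {m : ℝ} (h : IsMConvex Ω m) (hn : n ≠ 0) : Ω ≠ univ := by
  rintro rfl
  have : Nonempty (Fin n) := ⟨⟨0, Nat.pos_of_ne_zero hn⟩⟩
  exact NormedSpace.unbounded_univ ℂ (EuclideanSpace ℂ (Fin n)) h.isBounded

/-- This is the only use of the m-convexity inequality; later estimates need only a metric lower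
bound with some power of δ. -/
theorem IsMConvex.exists_kobayashiMetric_lower_bound {m : ℝ} (h : IsMConvex Ω m) :
    ∃ A : ℝ, 0 < A ∧ ∀ z ∈ Ω, ∀ v : EuclideanSpace ℂ (Fin n),
      ENNReal.ofReal (‖v‖ / (A * bdryDist Ω z ^ (1 / m))) ≤ kobayashiMetric Ω z v := by
  obtain ⟨C, hC, hb⟩ := h.exists_bound
  refine ⟨2 * C, by positivity, fun z hz v => ?_⟩
  rcases eq_or_ne v 0 with rfl | hv
  · simp
  obtain ⟨hpos, hle⟩ := ofReal_le_kobayashiMetric_of_convex h.isOpen h.isBounded h.convex hz hv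
  refine le_trans (ENNReal.ofReal_le_ofReal ?_) hle
  have := hb z hz v hv
  rw [mul_assoc]
  gcongr

end

/-! ### Piecewise C¹ curves on arbitrary intervals -/

/-- `γ` is piecewise `C¹` on `[a, b]`. -/
def IsPiecewiseC1On {F : Type*} [NormedAddCommGroup F] [NormedSpace ℝ F] (γ : ℝ → F)
    (a b : ℝ) : Prop :=
  ∃ (k : ℕ) (t : ℕ → ℝ), Monotone t ∧ t 0 = a ∧ t k = b ∧
    ∀ i < k, ContDiffOn ℝ 1 γ (Icc (t i) (t (i + 1)))

namespace IsPiecewiseC1On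

variable {F : Type*} [NormedAddCommGroup F] [NormedSpace ℝ F] {γ : ℝ → F} {a b c : ℝ}

theorem le (h : IsPiecewiseC1On γ a b) : a ≤ b := by
  obtain ⟨k, t, hmono, rfl, rfl, -⟩ := h
  exact hmono (Nat.zero_le k)

/-- Induction along the partition: properties of intervals that hold for `C¹` pieces and are
additive hold for piecewise `C¹` curves. -/
theorem induction {P : ℝ → ℝ → Prop} (h : IsPiecewiseC1On γ a b) (hrefl : ∀ x, P x x)
    (hpiece : ∀ x y, a ≤ x → x ≤ y → y ≤ b → ContDiffOn ℝ 1 γ (Icc x y) → P x y)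
    (hadd : ∀ x y z, a ≤ x → x ≤ y → y ≤ z → z ≤ b → P x y → P y z → P x z) : P a b := by
  obtain ⟨k, t, hmono, ht0, htk, ht⟩ := h
  have : ∀ j ≤ k, P (t 0) (t j) := by
    intro j
    induction j with
    | zero => exact fun _ => hrefl _
    | succ j ih =>
      intro hj
      exact hadd _ (t j) _ ht0.ge (hmono (Nat.zero_le j)) (hmono j.le_succ) (htk ▸ hmono hj)
        (ih (by omega)) (hpiece _ _ (ht0 ▸ hmono (Nat.zero_le j)) (hmono j.le_succ)
          (htk ▸ hmono hj) (ht j hj))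
  simpa [ht0, htk] using this k le_rfl

theorem of_contDiffOn (hab : a ≤ b) (h : ContDiffOn ℝ 1 γ (Icc a b)) : IsPiecewiseC1On γ a b := by
  refine ⟨1, fun i => if i = 0 then a else b, ?_, by simp, by simp, ?_⟩
  · refine monotone_nat_of_le_succ fun i => ?_
    by_cases hi : i = 0 <;> simp [hi, hab]
  · intro i hi
    obtain rfl : i = 0 := by omega
    simpa using h

theorem mono {a' b' : ℝ} (h : IsPiecewiseC1On γ a b) (ha : a ≤ a') (hab : a' ≤ b') (hb : b' ≤ b) :
    IsPiecewiseC1On γ a' b' := by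
  obtain ⟨k, t, hmono, rfl, rfl, ht⟩ := h
  -- The partition is clamped to `[a', b']`; pieces outside collapse to single points.
  refine ⟨k, fun i => max a' (min b' (t i)), ?_, ?_, ?_, ?_⟩
  · intro i j hij
    have := hmono hij
    dsimp only
    gcongr
  · simp [ha]
  · simp [hb, hab]
  · intro i hi
    dsimp only
    have hle := hmono i.le_succ
    rcases le_or_gt (t (i + 1)) a' with h1 | h1
    · have e1 : max a' (min b' (t i)) = a' := max_eq_left ((min_le_right _ _).trans (hle.trans h1))
      have e2 : max a' (min b' (t (i + 1))) = a' := max_eq_left ((min_le_right _ _).trans h1)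
      rw [e1, e2, Icc_self]
      rintro x rfl
      exact contDiffWithinAt_singleton
    · rcases le_or_gt b' (t i) with h2 | h2
      · have e1 : max a' (min b' (t i)) = b' := by rw [min_eq_left h2, max_eq_right hab]
        have e2 : max a' (min b' (t (i + 1))) = b' := by
          rw [min_eq_left (h2.trans hle), max_eq_right hab]
        rw [e1, e2, Icc_self]
        rintro x rfl
        exact contDiffWithinAt_singleton
      · refine (ht i hi).mono (Icc_subset_Icc ?_ ?_)
        · rw [min_eq_right h2.le]
          exact le_max_right _ _
        · exact max_le h1.le (min_le_right _ _)

theorem append (h₁ : IsPiecewiseC1On γ a b) (h₂ : IsPiecewiseC1On γ b c) :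
    IsPiecewiseC1On γ a c := by
  obtain ⟨k₁, t₁, hm₁, rfl, rfl, ht₁⟩ := h₁
  obtain ⟨k₂, t₂, hm₂, h0, rfl, ht₂⟩ := h₂
  refine ⟨k₁ + k₂, fun i => if i ≤ k₁ then t₁ i else t₂ (i - k₁), ?_, by simp, ?_, ?_⟩
  · refine monotone_nat_of_le_succ fun i => ?_
    rcases lt_trichotomy i k₁ with h | rfl | h
    · simp only [h.le, if_true, Nat.succ_le_of_lt h]
      exact hm₁ i.le_succ
    · simp only [le_refl, if_true, Nat.not_succ_le_self, if_false]
      rw [← h0]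
      exact hm₂ (Nat.zero_le _)
    · simp only [h.not_ge, show ¬ i + 1 ≤ k₁ by omega, if_false]
      exact hm₂ (by omega)
  · rcases Nat.eq_zero_or_pos k₂ with rfl | h
    · simp [h0]
    · simp [show ¬ k₁ + k₂ ≤ k₁ by omega]
  · intro i hi
    rcases lt_trichotomy i k₁ with h | rfl | h
    · simp only [h.le, if_true, Nat.succ_le_of_lt h]
      exact ht₁ i h
    · simp only [le_refl, if_true, Nat.not_succ_le_self, if_false]
      rw [← h0, Nat.add_sub_cancel_left]
      exact ht₂ 0 (by omega)
    · simp only [h.not_ge, show ¬ i + 1 ≤ k₁ by omega, if_false]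
      rw [show i + 1 - k₁ = i - k₁ + 1 by omega]
      exact ht₂ _ (by omega)

theorem congr {γ' : ℝ → F} (h : IsPiecewiseC1On γ a b) (heq : EqOn γ' γ (Icc a b)) :
    IsPiecewiseC1On γ' a b := by
  obtain ⟨k, t, hmono, rfl, rfl, ht⟩ := h
  exact ⟨k, t, hmono, rfl, rfl, fun i hi => (ht i hi).congr fun x hx =>
    heq ⟨(hmono (Nat.zero_le _)).trans hx.1, hx.2.trans (hmono hi)⟩⟩

theorem comp_affine_of_pos (h : IsPiecewiseC1On γ a b) {p q : ℝ} (hp : 0 < p) :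
    IsPiecewiseC1On (fun s => γ (p * s + q)) ((a - q) / p) ((b - q) / p) := by
  obtain ⟨k, t, hmono, rfl, rfl, ht⟩ := h
  refine ⟨k, fun i => (t i - q) / p, fun i j hij => ?_, rfl, rfl, fun i hi => ?_⟩
  · have := hmono hij
    dsimp only
    gcongr
  · refine (ht i hi).comp (by fun_prop) fun x hx => ?_
    rw [mem_Icc, div_le_iff₀ hp, le_div_iff₀ hp] at hx
    constructor <;> linarith [hx.1, hx.2]

theorem comp_sub (h : IsPiecewiseC1On γ a b) (q : ℝ) :
    IsPiecewiseC1On (fun s => γ (q - s)) (q - b) (q - a) := by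
  obtain ⟨k, t, hmono, rfl, rfl, ht⟩ := h
  refine ⟨k, fun i => q - t (k - i), fun i j hij => ?_, by simp, by simp, fun i hi => ?_⟩
  · have := hmono (show k - j ≤ k - i by omega)
    dsimp only
    linarith
  · refine (ht (k - (i + 1)) (by omega)).comp (by fun_prop) fun x hx => ?_
    rw [show k - (i + 1) + 1 = k - i by omega]
    constructor <;> linarith [hx.1, hx.2]

end IsPiecewiseC1On

theorem setLIntegral_Icc_add_Icc (f : ℝ → ℝ≥0∞) {a b c : ℝ} (hab : a ≤ b) (hbc : b ≤ c) :
    ∫⁻ t in Icc a c, f t = (∫⁻ t in Icc a b, f t) + ∫⁻ t in Icc b c, f t := by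
  rw [← Icc_union_Ioc_eq_Icc hab hbc, lintegral_union measurableSet_Ioc, restrict_Ioc_eq_restrict_Icc]
  exact Set.disjoint_left.2 fun x hx hx' => absurd hx.2 hx'.1.not_ge

/-! ### Lengths of curves and the pseudometric properties of the Kobayashi distance -/

section
variable {n : ℕ} {Ω : Set (EuclideanSpace ℂ (Fin n))}

/-- Maps that contract the Kobayashi metric infinitesimally contract lengths of curves. -/
theorem edist_le_setLIntegral_kobayashiMetric {F : Type*} [NormedAddCommGroup F] [NormedSpace ℝ F]
    {φ : EuclideanSpace ℂ (Fin n) → F} {φ' : EuclideanSpace ℂ (Fin n) →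
      EuclideanSpace ℂ (Fin n) →L[ℝ] F} (hφ : ContDiffOn ℝ 1 φ Ω)
    (hφ' : ∀ z ∈ Ω, HasFDerivAt φ (φ' z) z) {γ : ℝ → EuclideanSpace ℂ (Fin n)} {a b : ℝ}
    (hγ : IsPiecewiseC1On γ a b) (hmaps : MapsTo γ (Icc a b) Ω)
    (hle : ∀ t ∈ Icc a b, ∀ v, ‖φ' (γ t) v‖ₑ ≤ kobayashiMetric Ω (γ t) v) :
    edist (φ (γ a)) (φ (γ b)) ≤ ∫⁻ t in Icc a b, kobayashiMetric Ω (γ t) (deriv γ t) := by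
  refine hγ.induction (P := fun x y => edist (φ (γ x)) (φ (γ y)) ≤
    ∫⁻ t in Icc x y, kobayashiMetric Ω (γ t) (deriv γ t)) (by simp) ?_ ?_
  · intro x y hax hxy hyb hC
    have hsub : Icc x y ⊆ Icc a b := Icc_subset_Icc hax hyb
    have hcomp : ContDiffOn ℝ 1 (φ ∘ γ) (Icc x y) := hφ.comp hC (hmaps.mono_left hsub)
    rw [edist_comm, edist_eq_enorm_sub]
    refine (enorm_sub_le_lintegral_deriv_of_contDiffOn_Icc hcomp hxy).trans ?_
    -- The endpoints are discarded because γ need not be differentiable at the breakpoints, where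
    -- `deriv γ` carries no information.
    rw [← restrict_Ioo_eq_restrict_Icc]
    refine setLIntegral_mono' measurableSet_Ioo fun t ht => ?_
    have htI : t ∈ Icc a b := hsub (Ioo_subset_Icc_self ht)
    have hγd : HasDerivAt γ (deriv γ t) t :=
      ((hC.differentiableOn one_ne_zero).differentiableAt (Icc_mem_nhds ht.1 ht.2)).hasDerivAt
    rw [((hφ' _ (hmaps htI)).comp_hasDerivAt t hγd).deriv]
    exact hle t htI _
  · intro x y z _ hxy hyz _ h1 h2
    rw [setLIntegral_Icc_add_Icc _ hxy hyz]
    exact (edist_triangle _ _ _).trans (add_le_add h1 h2)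

/-- Reparametrization by an affine map with nonzero slope does not increase Kobayashi lengths. -/
theorem setLIntegral_kobayashiMetric_comp_affine_le (γ : ℝ → EuclideanSpace ℂ (Fin n)) {p : ℝ}
    (hp : p ≠ 0) (q : ℝ) {s : Set ℝ} (hs : MeasurableSet s) :
    ∫⁻ t in s, kobayashiMetric Ω (γ (p * t + q)) (deriv (fun t => γ (p * t + q)) t) ≤
      ∫⁻ t in (fun t => p * t + q) '' s, kobayashiMetric Ω (γ t) (deriv γ t) := by
  have hd : ∀ x ∈ s, HasDerivWithinAt (fun t => p * t + q) p s x := fun x _ => by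
    simpa using (((hasDerivAt_id x).const_mul p).add_const q).hasDerivWithinAt
  rw [lintegral_image_eq_lintegral_abs_deriv_mul hs hd (fun x _ y _ h => by simpa [hp] using h)]
  refine lintegral_mono fun t => ?_
  have : deriv (fun t => γ (p * t + q)) t = p • deriv γ (p * t + q) := by
    have := deriv_comp_mul_left p (fun u => γ (u + q)) t
    rw [this, deriv_comp_add_const]
  rw [this]
  exact kobayashiMetric_real_smul_le _ _ _ hp

theorem kobayashiMetric_zero {z : EuclideanSpace ℂ (Fin n)} (hz : z ∈ Ω) :
    kobayashiMetric Ω z 0 = 0 :=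
  le_antisymm (sInf_le ⟨fun _ => z, 0, differentiableOn_const _, fun _ _ => hz, rfl,
    by simp, by simp⟩) zero_le

theorem kobayashiEDist_self {z : EuclideanSpace ℂ (Fin n)} (hz : z ∈ Ω) :
    kobayashiEDist Ω z z = 0 := by
  refine le_antisymm (sInf_le ⟨fun _ => z, ?_, fun _ _ => hz, rfl, rfl, ?_⟩) zero_le
  · exact IsPiecewiseC1On.of_contDiffOn zero_le_one contDiffOn_const
  · simp [kobayashiLength, kobayashiMetric_zero hz]

theorem kobayashiEDist_le_setLIntegral {γ : ℝ → EuclideanSpace ℂ (Fin n)} {a b : ℝ}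
    (hγ : IsPiecewiseC1On γ a b) (hmaps : MapsTo γ (Icc a b) Ω) :
    kobayashiEDist Ω (γ a) (γ b) ≤ ∫⁻ t in Icc a b, kobayashiMetric Ω (γ t) (deriv γ t) := by
  rcases hγ.le.eq_or_lt with rfl | hab
  · rw [kobayashiEDist_self (hmaps (by simp))]
    exact zero_le
  have hp : 0 < b - a := sub_pos.2 hab
  have himg : (fun t => (b - a) * t + a) '' Icc 0 1 = Icc a b := by
    rw [image_affine_Icc' hp]
    simp
  have hC := hγ.comp_affine_of_pos (q := a) hp
  rw [sub_self, zero_div, div_self hp.ne'] at hC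
  refine le_trans (sInf_le ⟨fun t => γ ((b - a) * t + a), hC, ?_, by simp, by simp, rfl⟩) ?_
  · intro t ht
    exact hmaps (himg ▸ mem_image_of_mem _ ht)
  · rw [← himg]
    exact setLIntegral_kobayashiMetric_comp_affine_le γ hp.ne' a measurableSet_Icc

theorem kobayashiEDist_comm_le (x y : EuclideanSpace ℂ (Fin n)) :
    kobayashiEDist Ω x y ≤ kobayashiEDist Ω y x := by
  refine le_sInf ?_
  rintro r ⟨γ, hγ, hmaps, h0, h1, rfl⟩
  have hC := IsPiecewiseC1On.comp_sub hγ 1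
  rw [sub_self, sub_zero] at hC
  refine le_trans (sInf_le ⟨fun t => γ (1 - t), hC, ?_, by simpa, by simpa, rfl⟩) ?_
  · intro t ht
    exact hmaps ⟨by linarith [ht.2], by linarith [ht.1]⟩
  · have := setLIntegral_kobayashiMetric_comp_affine_le (Ω := Ω) γ (p := -1) (by norm_num) 1
      (measurableSet_Icc (a := (0 : ℝ)) (b := 1))
    have himg : (fun t : ℝ => -1 * t + 1) '' Icc 0 1 = Icc 0 1 := by
      have : (fun t : ℝ => -1 * t + 1) = fun t => 1 - t := by ext; ring
      rw [this, image_const_sub_Icc]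
      simp
    rw [himg] at this
    have e : ∀ t : ℝ, -1 * t + 1 = 1 - t := fun t => by ring
    simp only [e] at this
    exact this

theorem kobayashiEDist_comm (x y : EuclideanSpace ℂ (Fin n)) :
    kobayashiEDist Ω x y = kobayashiEDist Ω y x :=
  le_antisymm (kobayashiEDist_comm_le x y) (kobayashiEDist_comm_le y x)

theorem kobayashiEDist_triangle (x y z : EuclideanSpace ℂ (Fin n)) :
    kobayashiEDist Ω x z ≤ kobayashiEDist Ω x y + kobayashiEDist Ω y z := by
  refine ENNReal.le_of_forall_pos_le_add fun ε hε hfin => ?_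
  have hε2 : (ε : ℝ≥0∞) / 2 ≠ 0 := by simpa using hε.ne'
  obtain ⟨r₁, ⟨γ₁, hγ₁, hm₁, h10, h11, rfl⟩, hr₁⟩ := sInf_lt_iff.1
    (ENNReal.lt_add_right (ENNReal.add_lt_top.1 hfin).1.ne hε2)
  obtain ⟨r₂, ⟨γ₂, hγ₂, hm₂, h20, h21, rfl⟩, hr₂⟩ := sInf_lt_iff.1
    (ENNReal.lt_add_right (ENNReal.add_lt_top.1 hfin).2.ne hε2)
  -- Concatenation of two curves optimal up to ε/2, the second shifted to `[1, 2]`; the result on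
  -- `[0, 2]` needs no explicit rescaling.
  set σ : ℝ → EuclideanSpace ℂ (Fin n) := fun t => if t ≤ 1 then γ₁ t else γ₂ (1 * t + -1) with hσ
  have hσ₁ : EqOn σ γ₁ (Icc 0 1) := fun t ht => if_pos ht.2
  have hσ₂ : EqOn σ (fun t => γ₂ (1 * t + -1)) (Icc 1 2) := by
    intro t ht
    rcases ht.1.eq_or_lt with rfl | h
    · simp [hσ, h11, h20]
    · exact if_neg h.not_ge
  have hC₁ : IsPiecewiseC1On σ 0 1 := IsPiecewiseC1On.congr hγ₁ hσ₁
  have hC₂ : IsPiecewiseC1On σ 1 2 := by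
    have := IsPiecewiseC1On.comp_affine_of_pos hγ₂ (q := -1) one_pos
    rw [show ((0 : ℝ) - -1) / 1 = 1 by norm_num, show ((1 : ℝ) - -1) / 1 = 2 by norm_num] at this
    exact this.congr hσ₂
  have himg : (fun t : ℝ => 1 * t + -1) '' Icc 1 2 = Icc 0 1 := by
    rw [image_affine_Icc' one_pos]
    norm_num
  have hmaps : MapsTo σ (Icc 0 2) Ω := by
    intro t ht
    rcases le_total t 1 with h | h
    · rw [hσ₁ ⟨ht.1, h⟩]
      exact hm₁ ⟨ht.1, h⟩
    · rw [hσ₂ ⟨h, ht.2⟩]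
      exact hm₂ (himg ▸ mem_image_of_mem _ (⟨h, ht.2⟩ : t ∈ Icc (1 : ℝ) 2))
  have hlen : ∀ (τ : ℝ → EuclideanSpace ℂ (Fin n)) (a b : ℝ), EqOn σ τ (Icc a b) →
      ∫⁻ t in Icc a b, kobayashiMetric Ω (σ t) (deriv σ t) =
        ∫⁻ t in Icc a b, kobayashiMetric Ω (τ t) (deriv τ t) := by
    intro τ a b h
    rw [← restrict_Ioo_eq_restrict_Icc]
    refine setLIntegral_congr_fun measurableSet_Ioo fun t ht => ?_
    have : σ =ᶠ[nhds t] τ := by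
      filter_upwards [Icc_mem_nhds ht.1 ht.2] with u hu using h hu
    simp only [this.deriv_eq, this.eq_of_nhds]
  have hx : σ 0 = x := by rw [hσ₁ (by simp), h10]
  have hz : σ 2 = z := by
    rw [hσ₂ (by simp)]
    norm_num [h21]
  calc kobayashiEDist Ω x z = kobayashiEDist Ω (σ 0) (σ 2) := by rw [hx, hz]
    _ ≤ ∫⁻ t in Icc 0 2, kobayashiMetric Ω (σ t) (deriv σ t) :=
      kobayashiEDist_le_setLIntegral (hC₁.append hC₂) hmaps
    _ ≤ kobayashiLength Ω γ₁ + kobayashiLength Ω γ₂ := by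
      rw [setLIntegral_Icc_add_Icc _ zero_le_one one_le_two, hlen _ _ _ hσ₁, hlen _ _ _ hσ₂]
      refine add_le_add le_rfl ?_
      refine (setLIntegral_kobayashiMetric_comp_affine_le γ₂ one_ne_zero (-1)
        measurableSet_Icc).trans ?_
      rw [himg]
      rfl
    _ ≤ (kobayashiEDist Ω x y + ε / 2) + (kobayashiEDist Ω y z + ε / 2) := add_le_add hr₁.le hr₂.le
    _ = kobayashiEDist Ω x y + kobayashiEDist Ω y z + ε := by
      rw [add_add_add_comm, ENNReal.add_halves]

end

/-! ### Growth of the boundary distance and comparison with the Euclidean distance -/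

section
variable {n : ℕ} {Ω : Set (EuclideanSpace ℂ (Fin n))}

/-- The differential of `½ log (c - Re L)` at z has size `|Re L v| / (2 (c - Re L z))`, which the
half-plane bound dominates by `K(z; v)`. -/
theorem edist_log_le_setLIntegral (L : EuclideanSpace ℂ (Fin n) →L[ℂ] ℂ) (c : ℝ)
    (hL : ∀ p ∈ Ω, (L p).re < c) {γ : ℝ → EuclideanSpace ℂ (Fin n)} {a b : ℝ}
    (hγ : IsPiecewiseC1On γ a b) (hmaps : MapsTo γ (Icc a b) Ω) :
    edist (2⁻¹ * Real.log (c - (L (γ a)).re)) (2⁻¹ * Real.log (c - (L (γ b)).re)) ≤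
      ∫⁻ t in Icc a b, kobayashiMetric Ω (γ t) (deriv γ t) := by
  set ℓ : EuclideanSpace ℂ (Fin n) →L[ℝ] ℝ := Complex.reCLM ∘L (L.restrictScalars ℝ) with hℓ
  have hℓz : ∀ z, ℓ z = (L z).re := fun z => rfl
  have hpos : ∀ z ∈ Ω, 0 < c - ℓ z := fun z hz => sub_pos.2 (hL z hz)
  refine edist_le_setLIntegral_kobayashiMetric (φ := fun z => 2⁻¹ * Real.log (c - ℓ z))
    (φ' := fun z => (2⁻¹ : ℝ) • (c - ℓ z)⁻¹ • (-ℓ)) ?_ ?_ hγ hmaps ?_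
  · exact contDiffOn_const.mul ((contDiffOn_const.sub ℓ.contDiff.contDiffOn).log
      fun z hz => (hpos z hz).ne')
  · intro z hz
    exact ((ℓ.hasFDerivAt.const_sub c).log (hpos z hz).ne').const_mul _
  · intro t ht v
    have hp := hpos _ (hmaps ht)
    refine le_trans ?_ (ofReal_le_kobayashiMetric L c hL (hmaps ht) v)
    rw [← ofReal_norm]
    refine ENNReal.ofReal_le_ofReal ?_
    simp only [smul_apply, neg_apply, norm_smul, norm_neg]
    rw [Real.norm_of_nonneg (by positivity), Real.norm_of_nonneg (by positivity), ← hℓz,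
      div_eq_mul_inv, mul_inv, mul_comm ‖L v‖, mul_assoc]
    gcongr
    exact Complex.abs_re_le_norm (L v)

/-- Along a curve of Kobayashi length at most `ℓ` the boundary distance grows at most by `exp (2ℓ)`.
-/
theorem bdryDist_le_mul_exp_of_setLIntegral_le (ho : IsOpen Ω) (hconv : Convex ℝ Ω)
    (hne : Ω ≠ univ) {γ : ℝ → EuclideanSpace ℂ (Fin n)} {a b ℓ : ℝ}
    (hγ : IsPiecewiseC1On γ a b) (hmaps : MapsTo γ (Icc a b) Ω) (hℓ0 : 0 ≤ ℓ)
    (hℓ : ∫⁻ t in Icc a b, kobayashiMetric Ω (γ t) (deriv γ t) ≤ ENNReal.ofReal ℓ) :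
    bdryDist Ω (γ b) ≤ bdryDist Ω (γ a) * Real.exp (2 * ℓ) := by
  have ha := hmaps (left_mem_Icc.2 hγ.le)
  have hb := hmaps (right_mem_Icc.2 hγ.le)
  obtain ⟨L, c, hL, hcmp⟩ := exists_supporting_functional ho hconv hne ha
  have h1 := (edist_log_le_setLIntegral L c hL hγ hmaps).trans hℓ
  rw [edist_le_ofReal hℓ0, dist_comm, Real.dist_eq] at h1
  have h2 := (le_abs_self _).trans h1
  have hpa : 0 < c - (L (γ a)).re := sub_pos.2 (hL _ ha)
  have hpb : 0 < c - (L (γ b)).re := sub_pos.2 (hL _ hb)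
  have h3 : c - (L (γ b)).re ≤ (c - (L (γ a)).re) * Real.exp (2 * ℓ) := by
    rw [← Real.log_le_log_iff hpb (by positivity), Real.log_mul hpa.ne' (Real.exp_ne_zero _),
      Real.log_exp]
    linarith
  have h4 := hcmp _ hb
  have hδ := bdryDist_pos ho hne ha
  nlinarith

theorem exists_curve_of_kobayashiEDist_lt {x y : EuclideanSpace ℂ (Fin n)} {r : ℝ≥0∞}
    (h : kobayashiEDist Ω x y < r) : ∃ γ : ℝ → EuclideanSpace ℂ (Fin n),
      IsPiecewiseC1On γ 0 1 ∧ MapsTo γ (Icc 0 1) Ω ∧ γ 0 = x ∧ γ 1 = y ∧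
        ∫⁻ t in Icc 0 1, kobayashiMetric Ω (γ t) (deriv γ t) < r := by
  obtain ⟨_, ⟨γ, hγ, hm, h0, h1, rfl⟩, hr⟩ := sInf_lt_iff.1 h
  exact ⟨γ, hγ, hm, h0, h1, hr⟩

theorem bdryDist_le_mul_exp (ho : IsOpen Ω) (hconv : Convex ℝ Ω) (hne : Ω ≠ univ)
    {x y : EuclideanSpace ℂ (Fin n)} {d : ℝ} (hd : 0 ≤ d)
    (h : kobayashiEDist Ω x y ≤ ENNReal.ofReal d) :
    bdryDist Ω y ≤ bdryDist Ω x * Real.exp (2 * d) := by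
  have key : ∀ ℓ ∈ Ioi d, bdryDist Ω y ≤ bdryDist Ω x * Real.exp (2 * ℓ) := by
    intro ℓ (hℓ : d < ℓ)
    obtain ⟨γ, hγ, hm, rfl, rfl, hr⟩ := exists_curve_of_kobayashiEDist_lt
      (h.trans_lt ((ENNReal.ofReal_lt_ofReal_iff (hd.trans_lt hℓ)).2 hℓ))
    exact bdryDist_le_mul_exp_of_setLIntegral_le ho hconv hne hγ hm (hd.trans hℓ.le) hr.le
  -- The infimum defining the distance need not be attained, so the estimate is proved for curves of
  -- length below each ℓ > d, and then ℓ ↓ d.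
  refine ge_of_tendsto (x := nhdsWithin d (Ioi d)) (f := fun ℓ => bdryDist Ω x * Real.exp (2 * ℓ)) ?_
    (eventually_mem_nhdsWithin.mono key)
  exact (Continuous.tendsto (by fun_prop) d).mono_left nhdsWithin_le_nhds

/-- The Euclidean distance is controlled by the Kobayashi distance at small scales, with a gain
coming from the decay `δ ^ s` of the inverse of the Kobayashi metric. -/
theorem norm_sub_le_of_kobayashiEDist_le (ho : IsOpen Ω) (hconv : Convex ℝ Ω) (hne : Ω ≠ univ)
    {A s : ℝ} (hA : 0 < A) (hs : 0 ≤ s)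
    (hK : ∀ z ∈ Ω, ∀ v : EuclideanSpace ℂ (Fin n),
      ENNReal.ofReal (‖v‖ / (A * bdryDist Ω z ^ s)) ≤ kobayashiMetric Ω z v)
    {x y : EuclideanSpace ℂ (Fin n)} (hx : x ∈ Ω) {d : ℝ} (hd : 0 ≤ d)
    (h : kobayashiEDist Ω x y ≤ ENNReal.ofReal d) :
    ‖x - y‖ ≤ A * bdryDist Ω x ^ s * (d * Real.exp (2 * s * d)) := by
  have key : ∀ ℓ ∈ Ioi d, ‖x - y‖ ≤ A * bdryDist Ω x ^ s * (ℓ * Real.exp (2 * s * ℓ)) := by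
    intro ℓ (hℓ : d < ℓ)
    have hℓ0 : 0 ≤ ℓ := hd.trans hℓ.le
    obtain ⟨γ, hγ, hm, rfl, rfl, hr⟩ := exists_curve_of_kobayashiEDist_lt
      (h.trans_lt ((ENNReal.ofReal_lt_ofReal_iff (hd.trans_lt hℓ)).2 hℓ))
    have hδ0 := bdryDist_pos ho hne hx
    -- By the growth estimate B bounds `A δ ^ s` on the whole curve, so `B⁻¹ • id` contracts the
    -- Kobayashi metric along it.
    set B := A * (bdryDist Ω (γ 0) * Real.exp (2 * ℓ)) ^ s with hB
    have hBpos : 0 < B := by positivity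
    have hbd : ∀ t ∈ Icc (0 : ℝ) 1, A * bdryDist Ω (γ t) ^ s ≤ B := by
      intro t ht
      have hsub : Icc 0 t ⊆ Icc (0 : ℝ) 1 := Icc_subset_Icc_right ht.2
      have := bdryDist_le_mul_exp_of_setLIntegral_le ho hconv hne
        (hγ.mono le_rfl ht.1 ht.2) (hm.mono_left hsub) hℓ0
        ((lintegral_mono_set hsub).trans hr.le)
      exact mul_le_mul_of_nonneg_left
        (Real.rpow_le_rpow (bdryDist_pos ho hne (hm ht)).le this hs) hA.le
    have := edist_le_setLIntegral_kobayashiMetric (Ω := Ω)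
      (φ := fun z : EuclideanSpace ℂ (Fin n) => B⁻¹ • z)
      (φ' := fun _ => B⁻¹ • ContinuousLinearMap.id ℝ _) (by fun_prop)
      (fun z _ => (hasFDerivAt_id z).const_smul B⁻¹) hγ hm (fun t ht v => by
        refine le_trans ?_ (hK _ (hm ht) v)
        have hδt := bdryDist_pos ho hne (hm ht)
        rw [← ofReal_norm]
        refine ENNReal.ofReal_le_ofReal ?_
        simp only [smul_apply, ContinuousLinearMap.id_apply, norm_smul]
        rw [Real.norm_of_nonneg (by positivity), mul_comm, ← div_eq_mul_inv]
        have := hbd t ht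
        gcongr)
    have h2 := this.trans hr.le
    rw [edist_le_ofReal hℓ0, dist_eq_norm, ← smul_sub, norm_smul,
      Real.norm_of_nonneg (by positivity), inv_mul_le_iff₀ hBpos] at h2
    refine h2.trans (le_of_eq ?_)
    rw [hB, Real.mul_rpow hδ0.le (Real.exp_nonneg _), ← Real.exp_mul]
    rw [show 2 * ℓ * s = 2 * s * ℓ by ring]
    ring
  refine ge_of_tendsto (x := nhdsWithin d (Ioi d))
    (f := fun ℓ => A * bdryDist Ω x ^ s * (ℓ * Real.exp (2 * s * ℓ))) ?_
    (eventually_mem_nhdsWithin.mono key)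
  exact (Continuous.tendsto (by fun_prop) d).mono_left nhdsWithin_le_nhds

/-- By convexity the ball of radius r about every point of the segment from x to y lies in Ω, so the
segment has Kobayashi speed at most `‖x - y‖ / r`. -/
theorem kobayashiEDist_le_of_ball_subset (hconv : Convex ℝ Ω)
    {x y : EuclideanSpace ℂ (Fin n)} {r : ℝ} (hr : 0 < r)
    (hx : Metric.ball x r ⊆ Ω) (hy : Metric.ball y r ⊆ Ω) :
    kobayashiEDist Ω x y ≤ ENNReal.ofReal (‖x - y‖ / r) := by
  set γ : ℝ → EuclideanSpace ℂ (Fin n) := fun t => x + t • (y - x) with hγ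
  have hball : ∀ t ∈ Icc (0 : ℝ) 1, Metric.ball (γ t) r ⊆ Ω := by
    intro t ht p hp
    rw [mem_ball_iff_norm] at hp
    have hx' : x + (p - γ t) ∈ Ω := hx (by rwa [mem_ball_iff_norm, add_sub_cancel_left])
    have hy' : y + (p - γ t) ∈ Ω := hy (by rwa [mem_ball_iff_norm, add_sub_cancel_left])
    have := hconv hx' hy' (sub_nonneg.2 ht.2) ht.1 (sub_add_cancel 1 t)
    convert this using 1
    simp only [hγ]
    module
  have hd : ∀ t, HasDerivAt γ (y - x) t := fun t => by
    have := ((hasDerivAt_id t).smul_const (y - x)).const_add x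
    rwa [one_smul] at this
  have hC : IsPiecewiseC1On γ 0 1 :=
    IsPiecewiseC1On.of_contDiffOn zero_le_one (by fun_prop)
  have h := kobayashiEDist_le_setLIntegral hC fun t ht => hball t ht (Metric.mem_ball_self hr)
  simp only [hγ, zero_smul, add_zero, one_smul, add_sub_cancel] at h
  refine h.trans ?_
  calc _ ≤ ∫⁻ _ in Icc (0 : ℝ) 1, ENNReal.ofReal (‖x - y‖ / r) := by
        refine setLIntegral_mono' measurableSet_Icc fun t ht => ?_
        rw [(hd t).deriv, norm_sub_rev]
        exact kobayashiMetric_le_of_ball_subset hr (hball t ht) _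
    _ = _ := by simp

theorem kobayashiEDist_ne_top (ho : IsOpen Ω) (hconv : Convex ℝ Ω)
    {x y : EuclideanSpace ℂ (Fin n)} (hx : x ∈ Ω) (hy : y ∈ Ω) : kobayashiEDist Ω x y ≠ ∞ := by
  obtain ⟨r₁, hr₁, h₁⟩ := Metric.isOpen_iff.1 ho x hx
  obtain ⟨r₂, hr₂, h₂⟩ := Metric.isOpen_iff.1 ho y hy
  refine ne_top_of_le_ne_top ENNReal.ofReal_ne_top (kobayashiEDist_le_of_ball_subset hconv
    (lt_min hr₁ hr₂) ((Metric.ball_subset_ball (min_le_left _ _)).trans h₁)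
    ((Metric.ball_subset_ball (min_le_right _ _)).trans h₂))

end

/-! ### Existence of Kobayashi geodesics -/

section
variable {n : ℕ} {Ω : Set (EuclideanSpace ℂ (Fin n))}

/-- Absolute continuity of the integral. It makes the arc-length function continuous, so that it can
be inverted by the intermediate value theorem. -/
theorem continuousOn_toReal_setLIntegral_Icc {f : ℝ → ℝ≥0∞} {a b : ℝ}
    (hf : ∫⁻ t in Icc a b, f t ≠ ∞) :
    ContinuousOn (fun t => (∫⁻ u in Icc a t, f u).toReal) (Icc a b) := by
  have hfin : ∀ {s t}, a ≤ s → t ≤ b → ∫⁻ u in Icc s t, f u ≠ ∞ := fun hs ht =>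
    ne_top_of_le_ne_top hf (lintegral_mono_set (Icc_subset_Icc hs ht))
  rw [Metric.continuousOn_iff]
  intro s hs ε hε
  obtain ⟨δ, hδ, hlt⟩ := exists_pos_setLIntegral_lt_of_measure_lt hf
    (ε := ENNReal.ofReal ε) (by simpa using hε)
  obtain ⟨η, hη, hηδ⟩ : ∃ η : ℝ, 0 < η ∧ ENNReal.ofReal η ≤ δ := by
    rcases eq_or_ne δ ∞ with rfl | h
    · exact ⟨1, one_pos, le_top⟩
    · exact ⟨δ.toReal, ENNReal.toReal_pos hδ.ne' h, ENNReal.ofReal_toReal_le⟩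
  have key : ∀ p q, a ≤ p → p ≤ q → q ≤ b → q - p < η →
      |(∫⁻ u in Icc a q, f u).toReal - (∫⁻ u in Icc a p, f u).toReal| < ε := by
    intro p q hp hpq hq hd
    rw [setLIntegral_Icc_add_Icc f hp hpq,
      ENNReal.toReal_add (hfin le_rfl (hpq.trans hq)) (hfin hp hq), add_sub_cancel_left,
      abs_of_nonneg ENNReal.toReal_nonneg]
    have := hlt (Icc p q) (by
      refine lt_of_lt_of_le ?_ hηδ
      refine (Measure.restrict_apply_le _ _).trans_lt ?_
      rw [Real.volume_Icc]
      exact (ENNReal.ofReal_lt_ofReal_iff hη).2 hd)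
    rw [Measure.restrict_restrict measurableSet_Icc,
      inter_eq_left.2 (Icc_subset_Icc hp hq)] at this
    rw [← ENNReal.toReal_ofReal hε.le]
    exact (ENNReal.toReal_lt_toReal (hfin hp hq) ENNReal.ofReal_ne_top).2 this
  refine ⟨η, hη, fun t ht hd => ?_⟩
  rw [Real.dist_eq] at hd ⊢
  rcases le_total s t with h | h
  · exact key s t hs.1 h ht.2 ((le_abs_self _).trans_lt hd)
  · rw [abs_sub_comm]
    exact key t s ht.1 h hs.2 ((le_abs_self _).trans_lt (abs_sub_comm t s ▸ hd))

theorem kobayashiDist_nonneg (x y : EuclideanSpace ℂ (Fin n)) : 0 ≤ kobayashiDist Ω x y :=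
  ENNReal.toReal_nonneg

theorem kobayashiDist_comm (x y : EuclideanSpace ℂ (Fin n)) :
    kobayashiDist Ω x y = kobayashiDist Ω y x := by
  rw [kobayashiDist, kobayashiEDist_comm, kobayashiDist]

theorem kobayashiDist_triangle (ho : IsOpen Ω) (hconv : Convex ℝ Ω)
    {x y z : EuclideanSpace ℂ (Fin n)} (hx : x ∈ Ω) (hy : y ∈ Ω) (hz : z ∈ Ω) :
    kobayashiDist Ω x z ≤ kobayashiDist Ω x y + kobayashiDist Ω y z := by
  have h1 := kobayashiEDist_ne_top ho hconv hx hy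
  have h2 := kobayashiEDist_ne_top ho hconv hy hz
  rw [kobayashiDist, kobayashiDist, kobayashiDist, ← ENNReal.toReal_add h1 h2]
  exact ENNReal.toReal_mono (ENNReal.add_ne_top.2 ⟨h1, h2⟩) (kobayashiEDist_triangle x y z)

theorem ofReal_kobayashiDist (ho : IsOpen Ω) (hconv : Convex ℝ Ω)
    {x y : EuclideanSpace ℂ (Fin n)} (hx : x ∈ Ω) (hy : y ∈ Ω) :
    ENNReal.ofReal (kobayashiDist Ω x y) = kobayashiEDist Ω x y :=
  ENNReal.ofReal_toReal (kobayashiEDist_ne_top ho hconv hx hy)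

theorem IsMConvex.eq_of_kobayashiDist_le_zero {m : ℝ} (h : IsMConvex Ω m) (hn : n ≠ 0)
    {x y : EuclideanSpace ℂ (Fin n)} (hx : x ∈ Ω) (hy : y ∈ Ω) (hd : kobayashiDist Ω x y ≤ 0) :
    x = y := by
  obtain ⟨A, hA, hK⟩ := h.exists_kobayashiMetric_lower_bound
  have := norm_sub_le_of_kobayashiEDist_le h.isOpen h.convex (h.ne_univ hn) hA
    (one_div_nonneg.2 (zero_le_one.trans h.one_lt.le)) hK hx le_rfl (y := y)
    (by rw [← ofReal_kobayashiDist h.isOpen h.convex hx hy]; exact ENNReal.ofReal_le_ofReal hd)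
  rw [zero_mul, mul_zero, norm_le_zero_iff, sub_eq_zero] at this
  exact this

/-- Arc-length parametrizations of almost length-minimizing curves. -/
theorem exists_almost_geodesic (ho : IsOpen Ω) (hconv : Convex ℝ Ω)
    {x y : EuclideanSpace ℂ (Fin n)} (hx : x ∈ Ω) (hy : y ∈ Ω) {ε : ℝ} (hε : 0 < ε) :
    ∃ g : ℝ → EuclideanSpace ℂ (Fin n), (∀ s, g s ∈ Ω) ∧
      (∀ s, kobayashiDist Ω x (g s) ≤ kobayashiDist Ω x y + ε) ∧
      (∀ s ∈ Icc 0 (kobayashiDist Ω x y), ∀ t ∈ Icc 0 (kobayashiDist Ω x y),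
        kobayashiDist Ω (g s) (g t) ≤ |s - t|) ∧
      kobayashiDist Ω x (g 0) ≤ 0 ∧ kobayashiDist Ω (g (kobayashiDist Ω x y)) y ≤ ε := by
  set T := kobayashiDist Ω x y with hT
  have hT0 : 0 ≤ T := kobayashiDist_nonneg x y
  have hlt : kobayashiEDist Ω x y < ENNReal.ofReal (T + ε) := by
    rw [← ofReal_kobayashiDist ho hconv hx hy, ENNReal.ofReal_lt_ofReal_iff (by positivity)]
    linarith
  obtain ⟨σ, hσ, hm, h0, h1, hlen⟩ := exists_curve_of_kobayashiEDist_lt hlt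
  set f : ℝ → ℝ≥0∞ := fun t => kobayashiMetric Ω (σ t) (deriv σ t) with hf
  have hfin1 : ∫⁻ t in Icc 0 1, f t ≠ ∞ := hlen.ne_top
  have hfin : ∀ {s t : ℝ}, 0 ≤ s → t ≤ 1 → ∫⁻ u in Icc s t, f u ≠ ∞ := fun hs ht =>
    ne_top_of_le_ne_top hfin1 (lintegral_mono_set (Icc_subset_Icc hs ht))
  set ℓ : ℝ → ℝ := fun t => (∫⁻ u in Icc 0 t, f u).toReal with hℓ
  have hcont : ContinuousOn ℓ (Icc 0 1) := continuousOn_toReal_setLIntegral_Icc hfin1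
  have hdiff : ∀ s t, 0 ≤ s → s ≤ t → t ≤ 1 → kobayashiDist Ω (σ s) (σ t) ≤ ℓ t - ℓ s := by
    intro s t hs hst ht
    have e : ℓ t - ℓ s = (∫⁻ u in Icc s t, f u).toReal := by
      simp only [hℓ]
      rw [setLIntegral_Icc_add_Icc f hs hst,
        ENNReal.toReal_add (hfin le_rfl (hst.trans ht)) (hfin hs ht), add_sub_cancel_left]
    rw [e]
    exact ENNReal.toReal_mono (hfin hs ht) (kobayashiEDist_le_setLIntegral
      (hσ.mono hs hst ht) (hm.mono_left (Icc_subset_Icc hs ht)))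
  have hℓ0 : ℓ 0 = 0 := by simp [hℓ]
  have hℓ1 : ℓ 1 ≤ T + ε := by
    have := ENNReal.toReal_mono ENNReal.ofReal_ne_top hlen.le
    rwa [ENNReal.toReal_ofReal (by positivity)] at this
  have hTℓ : T ≤ ℓ 1 := by
    have := hdiff 0 1 le_rfl zero_le_one le_rfl
    rwa [h0, h1, hℓ0, sub_zero] at this
  -- A right inverse of arc length on `[0, T]`, not necessarily continuous; values for other s only
  -- have to lie in `[0, 1]`.
  have hex : ∀ s : ℝ, ∃ u ∈ Icc (0 : ℝ) 1, s ∈ Icc 0 T → ℓ u = s := by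
    intro s
    by_cases hs : s ∈ Icc 0 T
    · obtain ⟨u, hu, hus⟩ := intermediate_value_Icc zero_le_one hcont
        (show s ∈ Icc (ℓ 0) (ℓ 1) from ⟨hℓ0.le.trans hs.1, hs.2.trans hTℓ⟩)
      exact ⟨u, hu, fun _ => hus⟩
    · exact ⟨0, by simp, fun h => absurd h hs⟩
  choose u hu hus using hex
  have hmono : ∀ s t, 0 ≤ s → s ≤ t → t ≤ 1 → ℓ s ≤ ℓ t := fun s t hs hst ht => by
    linarith [hdiff s t hs hst ht, kobayashiDist_nonneg (Ω := Ω) (σ s) (σ t)]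
  refine ⟨fun s => σ (u s), fun s => hm (hu s), ?_, ?_, ?_, ?_⟩
  · intro s
    have := hdiff 0 (u s) le_rfl (hu s).1 (hu s).2
    rw [h0, hℓ0] at this
    linarith [hmono (u s) 1 (hu s).1 (hu s).2 le_rfl]
  · intro s hs t ht
    rcases le_total (u s) (u t) with h | h
    · have := hdiff _ _ (hu s).1 h (hu t).2
      rw [hus s hs, hus t ht] at this
      rw [abs_sub_comm]
      exact this.trans (le_abs_self _)
    · have := hdiff _ _ (hu t).1 h (hu s).2
      rw [hus s hs, hus t ht, kobayashiDist_comm] at this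
      exact this.trans (le_abs_self _)
  · have := hdiff 0 (u 0) le_rfl (hu 0).1 (hu 0).2
    rwa [h0, hℓ0, hus 0 ⟨le_rfl, hT0⟩, sub_zero] at this
  · have := hdiff (u T) 1 (hu T).1 (hu T).2 le_rfl
    rw [h1, hus T ⟨hT0, le_rfl⟩] at this
    linarith

theorem kobayashiDist_le_of_ball_subset (hconv : Convex ℝ Ω)
    {x y : EuclideanSpace ℂ (Fin n)} {r : ℝ} (hr : 0 < r)
    (hx : Metric.ball x r ⊆ Ω) (hy : Metric.ball y r ⊆ Ω) :
    kobayashiDist Ω x y ≤ r⁻¹ * dist x y := by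
  have := ENNReal.toReal_mono ENNReal.ofReal_ne_top (kobayashiEDist_le_of_ball_subset hconv hr hx hy)
  rwa [ENNReal.toReal_ofReal (by positivity), div_eq_inv_mul, ← dist_eq_norm] at this

theorem continuous_kobayashiDist_of_ball_subset (ho : IsOpen Ω) (hconv : Convex ℝ Ω)
    {K : Set (EuclideanSpace ℂ (Fin n))} {r : ℝ} (hr : 0 < r)
    (hK : ∀ z ∈ K, Metric.ball z r ⊆ Ω) :
    Continuous fun p : K × K => kobayashiDist Ω (p.1 : EuclideanSpace ℂ (Fin n)) p.2 := by
  have hKΩ : ∀ z : K, (z : EuclideanSpace ℂ (Fin n)) ∈ Ω := fun z =>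
    hK z z.2 (Metric.mem_ball_self hr)
  have h1 : ∀ b : K, LipschitzWith (Real.toNNReal r⁻¹)
      fun a : K => kobayashiDist Ω (a : EuclideanSpace ℂ (Fin n)) b := by
    refine fun b => LipschitzWith.of_le_add_mul _ fun a a' => ?_
    rw [Real.coe_toNNReal _ (by positivity)]
    have := kobayashiDist_triangle ho hconv (hKΩ a) (hKΩ a') (hKΩ b)
    have := kobayashiDist_le_of_ball_subset hconv hr (hK a a.2) (hK a' a'.2)
    rw [Subtype.dist_eq]
    linarith
  have h2 : ∀ a : K, LipschitzWith (Real.toNNReal r⁻¹)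
      fun b : K => kobayashiDist Ω (a : EuclideanSpace ℂ (Fin n)) b := fun a => by
    simp_rw [kobayashiDist_comm (a : EuclideanSpace ℂ (Fin n))]
    exact h1 a
  exact (LipschitzWith.uncurry (f := fun a b : K => kobayashiDist Ω (a : EuclideanSpace ℂ (Fin n)) b)
    h1 h2).continuous

/-- Compactness is taken in the product `ℝ → K`: the 1-Lipschitz condition is closed under pointwise
limits, so no continuity of the approximating maps is required. -/
theorem IsMConvex.exists_isKobayashiGeodesic {m : ℝ} (h : IsMConvex Ω m) (hn : n ≠ 0)
    {x y : EuclideanSpace ℂ (Fin n)} (hx : x ∈ Ω) (hy : y ∈ Ω) :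
    ∃ γ : ℝ → EuclideanSpace ℂ (Fin n), IsKobayashiGeodesic Ω x y γ := by
  have ho := h.isOpen
  have hconv := h.convex
  have hne := h.ne_univ hn
  set T := kobayashiDist Ω x y with hT
  have hT0 : 0 ≤ T := kobayashiDist_nonneg x y
  -- The growth estimate gives δ ≥ r at every point within Kobayashi distance `T + 1` of x; the
  -- extra 1 absorbs the errors `1 / (k + 1)`.
  set r := bdryDist Ω x * Real.exp (-(2 * (T + 1))) with hr
  have hr0 : 0 < r := mul_pos (bdryDist_pos ho hne hx) (Real.exp_pos _)
  -- Distance to the complement, unlike distance to the frontier, vanishes off Ω, so K is a closed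
  -- subset of Ω.
  set K : Set (EuclideanSpace ℂ (Fin n)) := {z | r ≤ Metric.infDist z Ωᶜ} with hK
  have hKΩ : K ⊆ Ω := by
    intro z hz
    by_contra hzΩ
    have : Metric.infDist z Ωᶜ = 0 := Metric.infDist_zero_of_mem hzΩ
    rw [hK, mem_ofPred_eq, this] at hz
    linarith
  have hKball : ∀ z ∈ K, Metric.ball z r ⊆ Ω := fun z hz =>
    (Metric.ball_subset_ball hz).trans Metric.ball_infDist_compl_subset
  have hKcpt : IsCompact K := Metric.isCompact_of_isClosed_isBounded
    (isClosed_le continuous_const (Metric.continuous_infDist_pt _)) (h.isBounded.subset hKΩ)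
  have hmemK : ∀ z ∈ Ω, kobayashiDist Ω x z ≤ T + 1 → z ∈ K := by
    intro z hz hd
    have := bdryDist_le_mul_exp ho hconv hne (by positivity : 0 ≤ T + 1) (x := z) (y := x) (by
      rw [kobayashiEDist_comm, ← ofReal_kobayashiDist ho hconv hx hz]
      exact ENNReal.ofReal_le_ofReal hd)
    rw [hK, mem_ofPred_eq, ← bdryDist_eq_infDist_compl ho hne hz, hr, Real.exp_neg,
      ← div_eq_mul_inv, div_le_iff₀ (Real.exp_pos _)]
    exact this
  have : CompactSpace K := isCompact_iff_compactSpace.1 hKcpt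
  have hcont := continuous_kobayashiDist_of_ball_subset ho hconv hr0 hKball
  have hxK : x ∈ K := hmemK x hx (by
    have : kobayashiDist Ω x x = 0 := by simp [kobayashiDist, kobayashiEDist_self hx]
    rw [this]
    positivity)
  have hyK : y ∈ K := hmemK y hy (by linarith)
  set S : ℕ → Set (ℝ → K) := fun k => {g |
    (∀ s ∈ Icc 0 T, ∀ t ∈ Icc 0 T, kobayashiDist Ω (g s : EuclideanSpace ℂ (Fin n)) (g t) ≤ |s - t|) ∧
      kobayashiDist Ω x (g 0) ≤ 0 ∧ kobayashiDist Ω (g T : EuclideanSpace ℂ (Fin n)) y ≤ 1 / (k + 1)}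
    with hS
  have hcl : ∀ k, IsClosed (S k) := by
    intro k
    have hc : ∀ p q : (ℝ → K) → K, Continuous p → Continuous q →
        Continuous fun g => kobayashiDist Ω (p g : EuclideanSpace ℂ (Fin n)) (q g) :=
      fun p q hp hq => hcont.comp (hp.prodMk hq)
    have h1 : ∀ s t, IsClosed {g : ℝ → K |
        kobayashiDist Ω (g s : EuclideanSpace ℂ (Fin n)) (g t) ≤ |s - t|} := fun s t =>
      isClosed_le (hc _ _ (continuous_apply s) (continuous_apply t)) continuous_const
    have h2 : IsClosed {g : ℝ → K | kobayashiDist Ω x (g 0) ≤ 0} :=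
      isClosed_le (hc (fun _ => ⟨x, hxK⟩) _ continuous_const (continuous_apply 0)) continuous_const
    have h3 : IsClosed {g : ℝ → K |
        kobayashiDist Ω (g T : EuclideanSpace ℂ (Fin n)) y ≤ 1 / (k + 1)} :=
      isClosed_le (hc _ (fun _ => ⟨y, hyK⟩) (continuous_apply T) continuous_const) continuous_const
    have h4 : S k = (⋂ s ∈ Icc 0 T, ⋂ t ∈ Icc 0 T, {g : ℝ → K |
        kobayashiDist Ω (g s : EuclideanSpace ℂ (Fin n)) (g t) ≤ |s - t|}) ∩
          ({g | kobayashiDist Ω x (g 0) ≤ 0} ∩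
            {g | kobayashiDist Ω (g T : EuclideanSpace ℂ (Fin n)) y ≤ 1 / (k + 1)}) := by
      ext g
      simp only [hS, mem_inter_iff, mem_iInter, mem_ofPred_eq]
    rw [h4]
    exact (isClosed_biInter fun s _ => isClosed_biInter fun t _ => h1 s t).inter (h2.inter h3)
  have hnonempty : ∀ k, (S k).Nonempty := by
    intro k
    have hk : (0 : ℝ) < 1 / (k + 1) := by positivity
    have hk1 : (1 : ℝ) / (k + 1) ≤ 1 := by
      rw [div_le_one (by positivity)]
      linarith [(Nat.cast_nonneg k : (0 : ℝ) ≤ k)]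
    obtain ⟨g, hg, hgd, hgl, hg0, hgT⟩ := exists_almost_geodesic ho hconv hx hy hk
    exact ⟨fun s => ⟨g s, hmemK _ (hg s) ((hgd s).trans (by linarith))⟩, hgl, hg0, hgT⟩
  obtain ⟨g, hg⟩ := IsCompact.nonempty_iInter_of_sequence_nonempty_isCompact_isClosed S
    (fun k g hg => ⟨hg.1, hg.2.1, hg.2.2.trans (by push_cast; gcongr; linarith)⟩)
    hnonempty (hcl 0).isCompact hcl
  rw [mem_iInter] at hg
  have hgl := (hg 0).1
  have hg0 : x = g 0 := h.eq_of_kobayashiDist_le_zero hn hx (hKΩ (g 0).2) (hg 0).2.1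
  have hgT : (g T : EuclideanSpace ℂ (Fin n)) = y :=
    h.eq_of_kobayashiDist_le_zero hn (hKΩ (g T).2) hy
      (ge_of_tendsto' tendsto_one_div_add_atTop_nhds_zero_nat fun k => (hg k).2.2)
  -- A 1-Lipschitz path of duration `T = d(x, y)` from x to y has no slack: the triangle inequality
  -- through `g s` and `g t` forces equality.
  have hiso : ∀ s ∈ Icc 0 T, ∀ t ∈ Icc 0 T, s ≤ t →
      t - s ≤ kobayashiDist Ω (g s : EuclideanSpace ℂ (Fin n)) (g t) := by
    intro s hs t ht hst
    have h1 := hgl 0 ⟨le_rfl, hT0⟩ s hs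
    have h2 := hgl t ht T ⟨hT0, le_rfl⟩
    have h3 := kobayashiDist_triangle ho hconv hx (hKΩ (g s).2) hy
    have h4 := kobayashiDist_triangle ho hconv (hKΩ (g s).2) (hKΩ (g t).2) hy
    rw [← hg0, zero_sub, abs_neg, abs_of_nonneg hs.1] at h1
    rw [hgT, abs_sub_comm, abs_of_nonneg (sub_nonneg.2 ht.2)] at h2
    linarith
  refine ⟨fun s => g s, fun s _ => hKΩ (g s).2, hg0.symm, hgT, fun s hs t ht => ?_⟩
  rw [← ofReal_kobayashiDist ho hconv (hKΩ (g s).2) (hKΩ (g t).2)]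
  refine congrArg _ (le_antisymm (hgl s hs t ht) ?_)
  rcases le_total s t with hst | hst
  · rw [abs_sub_comm, abs_of_nonneg (sub_nonneg.2 hst)]
    exact hiso s hs t ht hst
  · rw [abs_of_nonneg (sub_nonneg.2 hst), kobayashiDist_comm]
    exact hiso t ht s hs hst

end

/-! ### Euclidean length of Kobayashi geodesics -/

/-- Chaining unit steps removes the restriction `t - s ≤ 1`; then g is monotone and its variation
dominates that of f. -/
theorem eVariationOn_Icc_le_of_dist_le {F : Type*} [PseudoMetricSpace F] {f : ℝ → F} {g : ℝ → ℝ}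
    {a b : ℝ} (hab : a ≤ b)
    (h : ∀ s ∈ Icc a b, ∀ t ∈ Icc a b, s ≤ t → t - s ≤ 1 → dist (f s) (f t) ≤ g t - g s) :
    eVariationOn f (Icc a b) ≤ ENNReal.ofReal (g b - g a) := by
  have hN : ∀ N : ℕ, ∀ s ∈ Icc a b, ∀ t ∈ Icc a b, s ≤ t → t - s ≤ N →
      dist (f s) (f t) ≤ g t - g s := by
    intro N
    induction N with
    | zero =>
      intro s hs t ht hst hd
      exact h s hs t ht hst (hd.trans (by simp))
    | succ N ih =>
      intro s hs t ht hst hd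
      rcases le_total t (s + 1) with h1 | h1
      · exact h s hs t ht hst (by linarith)
      · push_cast at hd
        have hm : s + 1 ∈ Icc a b := ⟨by linarith [hs.1], h1.trans ht.2⟩
        have := h s hs _ hm (by linarith) (by linarith)
        have := ih _ hm t ht h1 (by linarith)
        linarith [dist_triangle (f s) (f (s + 1)) (f t)]
  have hall : ∀ s ∈ Icc a b, ∀ t ∈ Icc a b, s ≤ t → dist (f s) (f t) ≤ g t - g s :=
    fun s hs t ht hst => hN _ s hs t ht hst (Nat.le_ceil _)
  have hmono : MonotoneOn g (Icc a b) := fun s hs t ht hst =>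
    sub_nonneg.1 (dist_nonneg.trans (hall s hs t ht hst))
  have hle : eVariationOn f (Icc a b) ≤ eVariationOn g (Icc a b) := by
    refine iSup_mono fun p => Finset.sum_le_sum fun i _ => ?_
    rw [edist_dist, edist_dist]
    refine ENNReal.ofReal_le_ofReal ?_
    rw [dist_comm, Real.dist_eq]
    exact (hall _ (p.2.2.2 i) _ (p.2.2.2 (i + 1)) (p.2.2.1 i.le_succ)).trans (le_abs_self _)
  refine hle.trans ?_
  simpa using (hmono.eVariationOn_eq (left_mem_Icc.2 hab) (right_mem_Icc.2 hab)).le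

section
variable {n : ℕ} {Ω : Set (EuclideanSpace ℂ (Fin n))}

/-- A discrete form of integrating the speed bound `A (δ(γ 0) exp (2t)) ^ σ`: increments of γ are
compared with those of a multiple of the primitive `exp (2σt)`. Restricting to `t - s ≤ 1` costs
only the factor `exp (2σ)`. -/
theorem eVariationOn_le_of_kobayashiEDist_le (ho : IsOpen Ω) (hconv : Convex ℝ Ω) (hne : Ω ≠ univ)
    {A σ : ℝ} (hA : 0 < A) (hσ : 0 < σ)
    (hK : ∀ z ∈ Ω, ∀ v : EuclideanSpace ℂ (Fin n),
      ENNReal.ofReal (‖v‖ / (A * bdryDist Ω z ^ σ)) ≤ kobayashiMetric Ω z v)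
    {γ : ℝ → EuclideanSpace ℂ (Fin n)} {b : ℝ} (hb : 0 ≤ b) (hmaps : MapsTo γ (Icc 0 b) Ω)
    (hγ : ∀ s ∈ Icc 0 b, ∀ t ∈ Icc 0 b, s ≤ t →
      kobayashiEDist Ω (γ s) (γ t) ≤ ENNReal.ofReal (t - s)) :
    eVariationOn γ (Icc 0 b) ≤ ENNReal.ofReal
      (A * Real.exp (2 * σ) / (2 * σ) * (bdryDist Ω (γ 0) * Real.exp (2 * b)) ^ σ) := by
  have h0 : (0 : ℝ) ∈ Icc 0 b := left_mem_Icc.2 hb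
  have hδ := bdryDist_pos ho hne (hmaps h0)
  set M := A * Real.exp (2 * σ) / (2 * σ) * bdryDist Ω (γ 0) ^ σ with hM
  have hM0 : 0 < M := by positivity
  refine (eVariationOn_Icc_le_of_dist_le (g := fun t => M * Real.exp (2 * σ * t)) hb ?_).trans ?_
  · intro s hs t ht hst h1
    have hδs := bdryDist_pos ho hne (hmaps hs)
    have hle : bdryDist Ω (γ s) ≤ bdryDist Ω (γ 0) * Real.exp (2 * s) :=
      bdryDist_le_mul_exp ho hconv hne hs.1 (by simpa using hγ 0 h0 s hs hs.1)
    have hle' : bdryDist Ω (γ s) ^ σ ≤ bdryDist Ω (γ 0) ^ σ * Real.exp (2 * σ * s) := by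
      have := Real.rpow_le_rpow hδs.le hle hσ.le
      rwa [Real.mul_rpow hδ.le (Real.exp_nonneg _), ← Real.exp_mul,
        show 2 * s * σ = 2 * σ * s by ring] at this
    have hdist := norm_sub_le_of_kobayashiEDist_le ho hconv hne hA hσ.le hK (hmaps hs)
      (sub_nonneg.2 hst) (hγ s hs t ht hst)
    have hexp : Real.exp (2 * σ * (t - s)) ≤ Real.exp (2 * σ) := by
      rw [Real.exp_le_exp]
      nlinarith
    have hconvex : Real.exp (2 * σ * s) * (2 * σ * (t - s)) ≤
        Real.exp (2 * σ * t) - Real.exp (2 * σ * s) := by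
      have e : Real.exp (2 * σ * t) = Real.exp (2 * σ * s) * Real.exp (2 * σ * (t - s)) := by
        rw [← Real.exp_add]
        ring_nf
      rw [e]
      nlinarith [Real.add_one_le_exp (2 * σ * (t - s)), Real.exp_pos (2 * σ * s)]
    have hts : 0 ≤ t - s := sub_nonneg.2 hst
    rw [dist_eq_norm]
    calc ‖γ s - γ t‖ ≤ A * bdryDist Ω (γ s) ^ σ * ((t - s) * Real.exp (2 * σ * (t - s))) := hdist
      _ ≤ A * (bdryDist Ω (γ 0) ^ σ * Real.exp (2 * σ * s)) * ((t - s) * Real.exp (2 * σ)) := by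
        gcongr
      _ = M * (Real.exp (2 * σ * s) * (2 * σ * (t - s))) := by
        rw [hM]
        field_simp
      _ ≤ M * (Real.exp (2 * σ * t) - Real.exp (2 * σ * s)) := by gcongr
      _ = _ := by ring
  · refine ENNReal.ofReal_le_ofReal ?_
    rw [Real.mul_rpow hδ.le (Real.exp_nonneg _), ← Real.exp_mul, ← mul_assoc, ← hM,
      show 2 * b * σ = 2 * σ * b by ring]
    have := mul_pos hM0 (Real.exp_pos (2 * σ * 0))
    linarith

/-- The Euclidean length of a Kobayashi geodesic of length `T` is at most a constant times
`(√(δ(x) δ(y)) exp T) ^ σ` if the Kobayashi metric grows like `δ ^ (-σ)`. -/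
theorem IsKobayashiGeodesic.euclideanLength_le (ho : IsOpen Ω) (hconv : Convex ℝ Ω)
    (hne : Ω ≠ univ) {A σ : ℝ} (hA : 0 < A) (hσ : 0 < σ)
    (hK : ∀ z ∈ Ω, ∀ v : EuclideanSpace ℂ (Fin n),
      ENNReal.ofReal (‖v‖ / (A * bdryDist Ω z ^ σ)) ≤ kobayashiMetric Ω z v)
    {x y : EuclideanSpace ℂ (Fin n)} {γ : ℝ → EuclideanSpace ℂ (Fin n)}
    (hγ : IsKobayashiGeodesic Ω x y γ) (hx : x ∈ Ω) (hy : y ∈ Ω) :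
    max (bdryDist Ω x) (bdryDist Ω y) ≤
        √(bdryDist Ω x * bdryDist Ω y) * Real.exp (kobayashiDist Ω x y) ∧
      euclideanLength γ (kobayashiDist Ω x y) ≤ ENNReal.ofReal (A * Real.exp (2 * σ) / σ *
        (√(bdryDist Ω x * bdryDist Ω y) * Real.exp (kobayashiDist Ω x y)) ^ σ) := by
  set T := kobayashiDist Ω x y with hT
  have hT0 : 0 ≤ T := kobayashiDist_nonneg x y
  have hδx := bdryDist_pos ho hne hx
  have hδy := bdryDist_pos ho hne hy
  set a := Real.log (bdryDist Ω x) with ha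
  set b := Real.log (bdryDist Ω y) with hb
  have hxa : bdryDist Ω x = Real.exp a := (Real.exp_log hδx).symm
  have hyb : bdryDist Ω y = Real.exp b := (Real.exp_log hδy).symm
  have hd : kobayashiEDist Ω x y ≤ ENNReal.ofReal T := (ofReal_kobayashiDist ho hconv hx hy).ge
  have hba : b ≤ a + 2 * T := by
    have := bdryDist_le_mul_exp ho hconv hne hT0 hd
    rwa [hxa, hyb, ← Real.exp_add, Real.exp_le_exp] at this
  have hab : a ≤ b + 2 * T := by
    have := bdryDist_le_mul_exp ho hconv hne hT0 (kobayashiEDist_comm x y ▸ hd)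
    rwa [hxa, hyb, ← Real.exp_add, Real.exp_le_exp] at this
  have hsqrt : √(bdryDist Ω x * bdryDist Ω y) = Real.exp ((a + b) / 2) := by
    rw [hxa, hyb, ← Real.exp_add, Real.exp_half]
  rw [hsqrt, ← Real.exp_add]
  refine ⟨max_le ?_ ?_, ?_⟩
  · rw [hxa, Real.exp_le_exp]
    linarith
  · rw [hyb, Real.exp_le_exp]
    linarith
  -- The balance point, solving `a + 2τ = b + 2(T - τ)`; both sides are then `(a + b) / 2 + T`. The
  -- growth estimate between x and y gives `0 ≤ τ ≤ T`.
  set τ := T / 2 + (b - a) / 4 with hτ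
  have hτ0 : 0 ≤ τ := by linarith
  have hτT : τ ≤ T := by linarith
  have hsub₁ : Icc 0 τ ⊆ Icc 0 T := Icc_subset_Icc_right hτT
  have hrev : ∀ s ∈ Icc 0 (T - τ), T - s ∈ Icc 0 T := fun s hs =>
    ⟨by linarith [hs.2], by linarith [hs.1]⟩
  have h₁ := eVariationOn_le_of_kobayashiEDist_le ho hconv hne hA hσ hK hτ0
    (hγ.mapsTo.mono_left hsub₁) (fun s hs t ht hst => by
      rw [hγ.isometry s (hsub₁ hs) t (hsub₁ ht), abs_sub_comm, abs_of_nonneg (sub_nonneg.2 hst)])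
  have h₂ := eVariationOn_le_of_kobayashiEDist_le (γ := γ ∘ fun s => T - s) ho hconv hne hA hσ hK
    (sub_nonneg.2 hτT) (fun s hs => hγ.mapsTo (hrev s hs)) (fun s hs t ht hst => by
      simp only [Function.comp_apply]
      rw [hγ.isometry _ (hrev s hs) _ (hrev t ht), show T - s - (T - t) = t - s by ring,
        abs_of_nonneg (sub_nonneg.2 hst)])
  rw [eVariationOn.comp_eq_of_antitoneOn _ _ (fun s _ t _ h => sub_le_sub_left h T),
    image_const_sub_Icc, sub_sub_cancel, sub_zero, Function.comp_apply, sub_zero, hγ.target, hyb,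
    ← Real.exp_add, show b + 2 * (T - τ) = (a + b) / 2 + T by rw [hτ]; ring] at h₂
  rw [hγ.source, hxa, ← Real.exp_add, show a + 2 * τ = (a + b) / 2 + T by rw [hτ]; ring] at h₁
  have hsplit := eVariationOn.Icc_add_Icc γ (s := univ) hτ0 hτT (mem_univ _)
  simp only [univ_inter] at hsplit
  rw [euclideanLength, ← hsplit]
  refine (add_le_add h₁ h₂).trans (le_of_eq ?_)
  rw [← ENNReal.ofReal_add (by positivity) (by positivity)]
  congr 1
  field_simp
  ring

end

/-! ### The distance estimate -/

theorem corollary1p4 (n : ℕ) (hn : 2 ≤ n) (m : ℝ) (Ω : Set (EuclideanSpace ℂ (Fin n)))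
    (hΩ : IsMConvex Ω m) :
    (∀ x ∈ Ω, ∀ y ∈ Ω, ∃ γ : ℝ → EuclideanSpace ℂ (Fin n), IsKobayashiGeodesic Ω x y γ) ∧
    ∃ C : ℝ, 0 < C ∧ ∀ x ∈ Ω, ∀ y ∈ Ω, ∀ γ : ℝ → EuclideanSpace ℂ (Fin n),
      IsKobayashiGeodesic Ω x y γ →
        euclideanLength γ (kobayashiDist Ω x y) ≠ ∞ ∧
        Real.log (((euclideanLength γ (kobayashiDist Ω x y)).toReal ^ m
            + max (bdryDist Ω x) (bdryDist Ω y)) / √(bdryDist Ω x * bdryDist Ω y)) - C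
          ≤ kobayashiDist Ω x y := by
  have hn0 : n ≠ 0 := by omega
  have hm : 0 < m := zero_lt_one.trans hΩ.one_lt
  have hne := hΩ.ne_univ hn0
  refine ⟨fun x hx y hy => hΩ.exists_isKobayashiGeodesic hn0 hx hy, ?_⟩
  obtain ⟨A, hA, hK⟩ := hΩ.exists_kobayashiMetric_lower_bound
  set B := A * Real.exp (2 * (1 / m)) / (1 / m) with hB
  have hB0 : 0 < B := by positivity
  have hBm : 0 < B ^ m := by positivity
  -- The summand `B ^ m` comes from `L ^ m ≤ B ^ m P`, and the summand 1 from `max (δ(x), δ(y)) ≤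
  -- P`.
  refine ⟨Real.log (B ^ m + 1), Real.log_pos (by linarith), fun x hx y hy γ hγ => ?_⟩
  obtain ⟨hmax, hlen⟩ := hγ.euclideanLength_le hΩ.isOpen hΩ.convex hne hA (one_div_pos.2 hm) hK hx hy
  refine ⟨ne_top_of_le_ne_top ENNReal.ofReal_ne_top hlen, ?_⟩
  have hδx := bdryDist_pos hΩ.isOpen hne hx
  have hδy := bdryDist_pos hΩ.isOpen hne hy
  have hs : 0 < √(bdryDist Ω x * bdryDist Ω y) := by positivity
  set P := √(bdryDist Ω x * bdryDist Ω y) * Real.exp (kobayashiDist Ω x y) with hP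
  have hP0 : 0 < P := by positivity
  set ℓ := (euclideanLength γ (kobayashiDist Ω x y)).toReal with hℓ
  have hℓ0 : 0 ≤ ℓ := ENNReal.toReal_nonneg
  have hℓB : ℓ ≤ B * P ^ (1 / m) := by
    have := ENNReal.toReal_mono ENNReal.ofReal_ne_top hlen
    rwa [ENNReal.toReal_ofReal (by positivity)] at this
  have hpow : ℓ ^ m ≤ B ^ m * P := by
    have := Real.rpow_le_rpow hℓ0 hℓB hm.le
    rwa [Real.mul_rpow hB0.le (by positivity), ← Real.rpow_mul hP0.le, one_div_mul_cancel hm.ne',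
      Real.rpow_one] at this
  have hmaxpos : 0 < max (bdryDist Ω x) (bdryDist Ω y) := lt_max_of_lt_left hδx
  have hℓm : 0 ≤ ℓ ^ m := by positivity
  have hfrac : (ℓ ^ m + max (bdryDist Ω x) (bdryDist Ω y)) / √(bdryDist Ω x * bdryDist Ω y) ≤
      (B ^ m + 1) * Real.exp (kobayashiDist Ω x y) := by
    rw [div_le_iff₀ hs]
    have e : (B ^ m + 1) * Real.exp (kobayashiDist Ω x y) * √(bdryDist Ω x * bdryDist Ω y) =
        B ^ m * P + P := by
      rw [hP]
      ring
    linarith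
  have hlog := Real.log_le_log (by positivity) hfrac
  rw [Real.log_mul (by positivity) (Real.exp_ne_zero _), Real.log_exp] at hlog
  linarith
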